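/- Let $\mathbb F$ be an algebraically closed field (of any characteristic). For a finite group $H$ let $\mathrm{IBr}(H)$ be the set of isomorphism classes of irreducible $\mathbb F$-linear representations of $H$; for a subgroup $K\le H$ and $\zeta\in\mathrm{IBr}(K)$ let $\mathrm{IBr}(H\mid\zeta)$ be the set of those $\chi\in \mathrm{IBr}(H)$ whose restriction to $K$ has a submodule of class $\zeta$. Subscripts denote stabilizers: for $\psi\in\mathrm{IBr}(Y)$, $Y\le X$, the group $\mathrm{Aut}(X)_{Y,\psi}$ consists of the automorphisms of $X$ that stabilize $Y$ and fix $\psi$. A (normalized) projective representation of a group $A$ with cocycle $\alpha\in \mathrm Z^2(A,\mathbb F^\times)$ is a map $\mathcal P\colon A\to \mathrm{GL}_n(\mathbb F)$ with $\mathcal P(1)=1$ and $\mathcal P(a)\mathcal P(b)=\alpha(a,b)\mathcal P(ab)$ for all $a,b\in A$. **Condition (Coho).** Let $X\ge Y\ge Z=\mathrm Z(X)$ be finite groups, $\chi\in\mathrm{IBr}(X)$, $\psi\in\mathrm{IBr}(Y)$, and identify $X/Z$ with the group of inner automorphisms of $X$. The pair $(\chi,\psi)$ satisfies the condition with respect to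 $X\ge Y\ge Z$ if there are projective representations $\mathcal P$ of $\mathrm{Aut}(X)_\chi$ and $\mathcal Q$ of $\mathrm{Aut}(X)_{Y,\psi}$, linear representations $\mathcal L$ of $X$ affording $\chi$ and $\mathcal M$ of $Y$ affording $\psi$, and a section $s\colon X/Z\to X$ of the quotient map with $s(1)=1$, such that $\mathcal P|_{X/Z}=\mathcal L\circ s$, $\mathcal Q|_{Y/Z}=\mathcal M\circ s|_{Y/Z}$, and the cocycles of $\mathcal P$ and $\mathcal Q$ coincide on $\mathrm{Aut}(X)_\chi\cap \mathrm{Aut}(X)_{Y,\psi}$. **Character triples.** A modular character triple $(G,N,\theta)$ consists of a finite group $G$, a normal subgroup $N$ and a $G$-invariant $\theta\in\mathrm{IBr}(N)$. Triples $(G,N,\theta)$ and $(\Gamma,M,\varphi)$ are isomorphic if there are an isomorphism $\tau\colon G/N\to \Gamma/M$ and, writing $K^\tau$ for the group with $M\le K^\tau\le \Gamma$ and $K^\tau/M=\tau(K/N)$, bijections $\sigma_K\colon \mathrm{IBr}(K\mid\theta)\to\mathrm{IBr}(K^\tau\mid\varphi)$ for all $N\le K\le G$, such that, after extending each $\sigma_K$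 additively to sums of elements of $\mathrm{IBr}(K\mid\theta)$ (a representation being identified with the sum of its composition factors), $\sigma_L(\chi|_L)=\sigma_K(\chi)|_{L^\tau}$ and $\sigma_K(\chi\beta)=\sigma_K(\chi)\beta^\tau$ for all $N\le L\le K\le G$, $\chi\in\mathrm{IBr}(K\mid\theta)$, $\beta\in\mathrm{IBr}(K/N)$. Here $\chi\beta$ is the tensor product with the inflation of $\beta$, and $\beta^\tau$ is the representation of $K^\tau/M$ corresponding to $\beta$ under $\tau$. **Theorem.** Let $Z=\mathrm Z(X)\le Y\le X\trianglelefteq G$ be finite groups, and let $\nu\in\mathrm{IBr}(Z)$, $\chi\in\mathrm{IBr}(X\mid\nu)$, $\psi\in\mathrm{IBr}(Y\mid\nu)$. Write $X'=[X,X]$, $Y'=Y\cap X'$, $Z'=Z\cap X'$. Assume (i) $X=X'Z$ and $Z\le \mathrm Z(G)$; (ii) $\mathrm N_X(Y)_\psi=Y$, $\mathrm N_G(Y)_\chi=\mathrm N_G(Y)_\psi$ and $G_\chi=X\cdot \mathrm N_G(Y)_\psi$; (iii) the restrictions $\chi|_{X'}$ and $\psi|_{Y'}$ satisfy Condition (Coho)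 with respect to $X'\ge Y'\ge Z'=\mathrm Z(X')$. Then the modular character triples $(G_\chi,X,\chi)$ and $(\mathrm N_G(Y)_\psi,Y,\psi)$ are isomorphic. Moreover $|\mathrm{IBr}(G\mid\chi)|=|\mathrm{IBr}(\mathrm N_G(Y)\mid\psi)|$. -/

import Mathlib

open scoped Pointwise

universe u v w

section RepClasses

variable {F : Type u} [Field F]

/-- Isomorphism of representations on the coordinate spaces `F ^ n`. -/
def repSetoid (F : Type u) [Field F] (G : Type v) [Group G] :
    Setoid (Σ n : ℕ, Representation F G (Fin n → F)) where
  r ρ σ := Nonempty (ρ.2.Equiv σ.2)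
  iseqv :=
    { refl := fun ρ => ⟨Representation.Equiv.refl ρ.2⟩
      symm := fun ⟨e⟩ => ⟨e.symm⟩
      trans := fun ⟨e⟩ ⟨f⟩ => ⟨e.trans f⟩ }

/-- The set of isomorphism classes of finite-dimensional `F`-linear representations of `G`. -/
def RepClass (F : Type u) [Field F] (G : Type v) [Group G] : Type (max u v) :=
  Quotient (repSetoid F G)

/-- Transport of a representation along a linear isomorphism. -/
def transportRep {G : Type v} [Group G] {V W : Type*} [AddCommGroup V] [Module F V]
    [AddCommGroup W] [Module F W] (ρ : Representation F G V) (e : V ≃ₗ[F] W) :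
    Representation F G W where
  toFun g := e.conj (ρ g)
  map_one' := by ext; simp
  map_mul' g h := by ext; simp

/-- The transported representation is isomorphic to the original one. -/
def transportRepEquiv {G : Type v} [Group G] {V W : Type*} [AddCommGroup V] [Module F V]
    [AddCommGroup W] [Module F W] (ρ : Representation F G V) (e : V ≃ₗ[F] W) :
    ρ.Equiv (transportRep ρ e) :=
  Representation.Equiv.mk e (fun g => by ext x; simp [transportRep])

/-- The isomorphism class afforded by a finite-dimensional representation. -/
noncomputable def repClass {G : Type v} [Group G] {V : Type*} [AddCommGroup V] [Module F V]
    [Module.Finite F V] (ρ : Representation F G V) : RepClass F G :=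
  Quotient.mk (repSetoid F G)
    ⟨Module.finrank F V, transportRep ρ (Module.finBasis F V).equivFun⟩

theorem repClass_eq_iff {G : Type v} [Group G] {V W : Type*} [AddCommGroup V] [Module F V]
    [Module.Finite F V] [AddCommGroup W] [Module F W] [Module.Finite F W]
    (ρ : Representation F G V) (σ : Representation F G W) :
    repClass ρ = repClass σ ↔ Nonempty (ρ.Equiv σ) := by
  constructor
  · intro h
    obtain ⟨e⟩ : Nonempty (Representation.Equiv _ _) := Quotient.exact h
    exact ⟨((transportRepEquiv ρ _).trans e).trans (transportRepEquiv σ _).symm⟩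
  · rintro ⟨e⟩
    exact Quotient.sound ⟨((transportRepEquiv ρ _).symm.trans e).trans (transportRepEquiv σ _)⟩

theorem repClass_surj {G : Type v} [Group G] (χ : RepClass F G) :
    ∃ (n : ℕ) (ρ : Representation F G (Fin n → F)), repClass ρ = χ := by
  induction χ using Quotient.inductionOn with
  | h ρ => exact ⟨ρ.1, ρ.2, Quotient.sound ⟨(transportRepEquiv ρ.2 _).symm⟩⟩

namespace RepClass

/-- Restriction (inflation, twisting) of isomorphism classes along a group homomorphism. -/
def res {G : Type v} {H : Type w} [Group G] [Group H] (χ : RepClass F G) (f : H →* G) :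
    RepClass F H :=
  Quotient.map' (s₁ := repSetoid F G) (s₂ := repSetoid F H)
    (fun ρ => ⟨ρ.1, ρ.2.comp f⟩)
    (fun _ _ ⟨e⟩ => ⟨Representation.Equiv.mk e.toLinearEquiv (fun h => e.isIntertwining' (f h))⟩) χ

theorem repClass_res {G : Type v} {H : Type w} [Group G] [Group H] {V : Type*} [AddCommGroup V]
    [Module F V] [Module.Finite F V] (ρ : Representation F G V) (f : H →* G) :
    (repClass ρ).res f = repClass (ρ.comp f : Representation F H V) := by
  rfl

theorem res_res {G : Type v} {H : Type w} {K : Type*} [Group G] [Group H] [Group K]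
    (χ : RepClass F G) (f : H →* G) (g : K →* H) : (χ.res f).res g = χ.res (f.comp g) := by
  obtain ⟨n, ρ, rfl⟩ := repClass_surj χ
  rfl

theorem res_id {G : Type v} [Group G] (χ : RepClass F G) : χ.res (MonoidHom.id G) = χ := by
  obtain ⟨n, ρ, rfl⟩ := repClass_surj χ
  rfl

/-- The tensor product (product of characters) of two isomorphism classes. -/
noncomputable def tensor {G : Type v} [Group G] (χ χ' : RepClass F G) : RepClass F G :=
  Quotient.liftOn₂ (s₁ := repSetoid F G) (s₂ := repSetoid F G) χ χ'
    (fun ρ σ => repClass (ρ.2.tprod σ.2))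
    (fun _ _ _ _ ⟨e⟩ ⟨e'⟩ => (repClass_eq_iff _ _).2
      ⟨Representation.Equiv.mk (TensorProduct.congr e.toLinearEquiv e'.toLinearEquiv)
        (fun g => by
          ext x y
          have h1 := LinearMap.congr_fun (e.isIntertwining' g)
          have h2 := LinearMap.congr_fun (e'.isIntertwining' g)
          simp only [LinearMap.comp_apply] at h1 h2
          simp only [TensorProduct.AlgebraTensorModule.curry_apply, LinearMap.restrictScalars_self,
            TensorProduct.curry_apply, LinearMap.comp_apply, Representation.tprod_apply,
            TensorProduct.map_tmul, LinearEquiv.coe_coe, TensorProduct.congr_tmul]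
          exact congrArg₂ _ (h1 _) (h2 _))⟩)

/-- `θ` is the class of a submodule of a module of class `χ`. -/
def IsSubOf {G : Type v} [Group G] (θ χ : RepClass F G) : Prop :=
  ∃ (m n : ℕ) (σ : Representation F G (Fin m → F)) (ρ : Representation F G (Fin n → F)),
    repClass σ = θ ∧ repClass ρ = χ ∧
      ∃ f : σ.IntertwiningMap ρ, Function.Injective f.toLinearMap

/-- `CompFactors χ m` : the modules of class `χ` have a composition series whose factors have the
classes listed (with multiplicity) in `m`. Identifying multisets of simple classes with the
corresponding sums of irreducible (Brauer) characters, `m` is the decomposition of (the character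
of) `χ` into irreducible ones. -/
inductive CompFactors {G : Type v} [Group G] : RepClass F G → Multiset (RepClass F G) → Prop
  | zero (ρ : Representation F G (Fin 0 → F)) : CompFactors (repClass ρ) 0
  | cons {n : ℕ} (ρ : Representation F G (Fin n → F)) (U : Submodule F (Fin n → F))
      (hU : ∀ g, U ≤ U.comap (ρ g)) (hirr : (ρ.quotient U hU).IsIrreducible)
      (m : Multiset (RepClass F G)) (hm : CompFactors (repClass (ρ.subrepresentation U hU)) m) :
      CompFactors (repClass ρ) (repClass (ρ.quotient U hU) ::ₘ m)

end RepClass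

/-- `IBr G`: the isomorphism classes of irreducible `F`-linear representations of `G`. -/
def IBr (F : Type u) [Field F] (G : Type v) [Group G] : Set (RepClass F G) :=
  {χ | ∃ (n : ℕ) (ρ : Representation F G (Fin n → F)), ρ.IsIrreducible ∧ repClass ρ = χ}

/-- `IBr (G | θ)` for a class `θ` of representations of `H`, where `H` is mapped to `G` by `f`
(in practice the inclusion of a subgroup): the irreducible classes whose restriction to `H` contains
a submodule of class `θ`. -/
def IBrOver {G : Type v} {H : Type w} [Group G] [Group H] (f : H →* G) (θ : RepClass F H) :
    Set (RepClass F G) :=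
  {χ | χ ∈ IBr F G ∧ θ.IsSubOf (χ.res f)}

end RepClasses

section Stabilizers

variable {F : Type u} [Field F]

/-- `Aut(X)_χ`. -/
def autStab {X : Type v} [Group X] (χ : RepClass F X) : Subgroup (MulAut X) where
  carrier := {a | χ.res a.toMonoidHom = χ}
  one_mem' := RepClass.res_id χ
  mul_mem' {a b} ha hb := by
    have h : (a * b : MulAut X).toMonoidHom = a.toMonoidHom.comp b.toMonoidHom := rfl
    simp only [Set.mem_ofPred_eq] at ha hb ⊢
    rw [h, ← RepClass.res_res, ha, hb]
  inv_mem' {a} ha := by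
    have h : a.toMonoidHom.comp (a⁻¹ : MulAut X).toMonoidHom = MonoidHom.id X := by
      ext x; exact a.apply_symm_apply x
    simp only [Set.mem_ofPred_eq] at ha ⊢
    conv_lhs => rw [← ha]
    rw [RepClass.res_res, h, RepClass.res_id]

/-- `Aut(X)_{Y,ψ}`: the automorphisms `a` of `X` that restrict to an automorphism `f` of `Y` which
fixes `ψ`. -/
def autPairStab {X : Type v} [Group X] (Y : Subgroup X) (ψ : RepClass F Y) :
    Subgroup (MulAut X) where
  carrier := {a | ∃ f : Y ≃* Y, (∀ y, (f y : X) = a y) ∧ ψ.res f.toMonoidHom = ψ}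
  one_mem' := ⟨MulEquiv.refl Y, fun _ => rfl, RepClass.res_id ψ⟩
  mul_mem' := by
    rintro a b ⟨f, hf, hf'⟩ ⟨g, hg, hg'⟩
    refine ⟨g.trans f, fun y => ?_, ?_⟩
    · simp [hf, hg]
    · have h : (g.trans f).toMonoidHom = f.toMonoidHom.comp g.toMonoidHom := rfl
      rw [h, ← RepClass.res_res, hf', hg']
  inv_mem' := by
    rintro a ⟨f, hf, hf'⟩
    refine ⟨f.symm, fun y => ?_, ?_⟩
    · apply a.injective
      rw [← hf, MulAut.apply_inv_self]
      simp
    · have h : f.toMonoidHom.comp f.symm.toMonoidHom = MonoidHom.id Y := by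
        ext y; exact congrArg _ (f.apply_symm_apply y)
      conv_lhs => rw [← hf']
      rw [RepClass.res_res, h, RepClass.res_id]

/-- For a subgroup `K` of `G` and a class `χ` of representations of `K`, the group
`N_G(K)_χ = {g ∈ N_G(K) | χ is fixed by conjugation with g}`. If `K` is normal in `G`, this is
the stabilizer `G_χ`. -/
def inertia {G : Type v} [Group G] (K : Subgroup G) (χ : RepClass F K) : Subgroup G :=
  (autPairStab K χ).comap MulAut.conj

end Stabilizers

section Coho

variable {F : Type u} [Field F]

/-- `P` is a (normalized) projective representation of `A` with cocycle `α`. -/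
structure IsProjRep {A : Type v} [Group A] {n : ℕ}
    (P : A → LinearMap.GeneralLinearGroup F (Fin n → F)) (α : A → A → Fˣ) : Prop where
  map_one : P 1 = 1
  cocycle : ∀ a b c, α a b * α (a * b) c = α b c * α a (b * c)
  map_mul : ∀ a b, ((P a * P b : LinearMap.GeneralLinearGroup F (Fin n → F)) :
    Module.End F (Fin n → F)) = (α a b : F) • (P (a * b) : Module.End F (Fin n → F))

/-- Späth's cohomological condition for `χ ∈ IBr X` and `ψ ∈ IBr Y`, where `Z(X) ≤ Y ≤ X`. Here
`L`, `M` are linear representations affording `χ`, `ψ` and `s` is a normalized section of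
`X → X / Z(X)`; the inner automorphism `conj x` corresponds to the coset `x Z(X)`. Since
`Z(X) ≤ Y`, the section `s` maps `Y / Z(X)` to `Y`. -/
def CohoCondition {X : Type v} [Group X] (Y : Subgroup X) (χ : RepClass F X) (ψ : RepClass F Y) :
    Prop :=
  ∃ (n m : ℕ)
    (P : autStab χ → LinearMap.GeneralLinearGroup F (Fin n → F))
    (α : autStab χ → autStab χ → Fˣ)
    (Q : autPairStab Y ψ → LinearMap.GeneralLinearGroup F (Fin m → F))
    (β : autPairStab Y ψ → autPairStab Y ψ → Fˣ)
    (L : Representation F X (Fin n → F)) (M : Representation F Y (Fin m → F))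
    (s : X ⧸ Subgroup.center X → X),
    IsProjRep P α ∧ IsProjRep Q β ∧ repClass L = χ ∧ repClass M = ψ ∧
    s 1 = 1 ∧ (∀ c, (QuotientGroup.mk (s c) : X ⧸ Subgroup.center X) = c) ∧
    -- the restriction of `P` to the inner automorphisms is `L ∘ s`
    (∀ (x : X) (a : autStab χ), (a : MulAut X) = MulAut.conj x →
      (P a : Module.End F (Fin n → F)) = L (s (QuotientGroup.mk x))) ∧
    -- the restriction of `Q` to the inner automorphisms coming from `Y` is `M ∘ s`
    (∀ (y : Y) (a : autPairStab Y ψ) (t : Y), (a : MulAut X) = MulAut.conj (y : X) →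
      (t : X) = s (QuotientGroup.mk (y : X)) → (Q a : Module.End F (Fin m → F)) = M t) ∧
    -- the cocycles agree on the intersection
    (∀ (a b : MulAut X) (ha : a ∈ autStab χ) (ha' : a ∈ autPairStab Y ψ)
      (hb : b ∈ autStab χ) (hb' : b ∈ autPairStab Y ψ),
      α ⟨a, ha⟩ ⟨b, hb⟩ = β ⟨a, ha'⟩ ⟨b, hb'⟩)

end Coho

section Triples

/-- A (modular) character triple `(G, N, θ)`: `N` is a normal subgroup of `G` and `θ ∈ IBr N` is
`G`-invariant. -/
structure CharTriple (F : Type u) [Field F] (G : Type v) [Group G] where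
  N : Subgroup G
  normal : N.Normal
  θ : RepClass F N
  irreducible : θ ∈ IBr F N
  invariant : inertia N θ = ⊤

namespace CharTriple

variable {F : Type u} [Field F]

instance {G : Type v} [Group G] (T : CharTriple F G) : T.N.Normal := T.normal

/-- The intermediate group `N ≤ K ≤ G` with `K / N = J`. -/
def pre {G : Type v} [Group G] (T : CharTriple F G) (J : Subgroup (G ⧸ T.N)) : Subgroup G :=
  J.comap (QuotientGroup.mk' T.N)

theorem le_pre {G : Type v} [Group G] (T : CharTriple F G) (J : Subgroup (G ⧸ T.N)) :
    T.N ≤ T.pre J :=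
  QuotientGroup.le_comap_mk' T.N J

/-- The projection `K → K / N = J`. -/
def proj {G : Type v} [Group G] (T : CharTriple F G) (J : Subgroup (G ⧸ T.N)) : T.pre J →* J :=
  (QuotientGroup.mk' T.N).subgroupComap J

/-- The inclusion between intermediate groups. -/
def incl {G : Type v} [Group G] (T : CharTriple F G) {J₁ J₂ : Subgroup (G ⧸ T.N)} (h : J₁ ≤ J₂) :
    T.pre J₁ →* T.pre J₂ :=
  Subgroup.inclusion (Subgroup.comap_mono h)

/-- `IBr (K | θ)` for the intermediate group `K` with `K / N = J`. -/
def irrOver {G : Type v} [Group G] (T : CharTriple F G) (J : Subgroup (G ⧸ T.N)) :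
    Set (RepClass F (T.pre J)) :=
  IBrOver (Subgroup.inclusion (T.le_pre J)) T.θ

/-- An isomorphism `(τ, σ)` of character triples `(G, N, θ)` and `(Γ, M, φ)`: an isomorphism
`τ : G / N ≃ Γ / M` together with bijections `σ_K : IBr (K | θ) → IBr (K^τ | φ)` for all
`N ≤ K ≤ G`, where `K^τ / M = τ (K / N)`. Extending every `σ_K` additively to the sums of elements
of `IBr (K | θ)`, these commute with restriction of characters and with multiplication by the
irreducible characters of `K / N`. The intermediate groups `K` are indexed by the subgroups
`J = K / N` of `G / N`, and sums of irreducible characters are multisets of composition factors.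
Only the values of `σ J` on `IBr (K | θ)` are relevant. -/
structure Iso {G : Type v} [Group G] {Γ : Type w} [Group Γ]
    (T : CharTriple F G) (T' : CharTriple F Γ) where
  τ : G ⧸ T.N ≃* Γ ⧸ T'.N
  σ : ∀ J : Subgroup (G ⧸ T.N), RepClass F (T.pre J) → RepClass F (T'.pre (J.map τ.toMonoidHom))
  bijOn : ∀ J, Set.BijOn (σ J) (T.irrOver J) (T'.irrOver (J.map τ.toMonoidHom))
  restrict : ∀ (J₁ J₂ : Subgroup (G ⧸ T.N)) (h : J₁ ≤ J₂), ∀ χ ∈ T.irrOver J₂,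
    ∀ m : Multiset (RepClass F (T.pre J₁)),
      (χ.res (T.incl h)).CompFactors m →
      ((σ J₂ χ).res (T'.incl (Subgroup.map_mono h))).CompFactors (m.map (σ J₁))
  mul : ∀ (J : Subgroup (G ⧸ T.N)), ∀ χ ∈ T.irrOver J, ∀ β ∈ IBr F J,
    ∀ m : Multiset (RepClass F (T.pre J)),
      (χ.tensor (β.res (T.proj J))).CompFactors m →
      ((σ J χ).tensor ((β.res (τ.subgroupMap J).symm.toMonoidHom).res
        (T'.proj (J.map τ.toMonoidHom)))).CompFactors (m.map (σ J))

end CharTriple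

variable {F : Type u} [Field F]

theorem le_inertia {G : Type v} [Group G] (K : Subgroup G) (χ : RepClass F K) :
    K ≤ inertia K χ := by
  intro k hk
  refine ⟨MulAut.conj (⟨k, hk⟩ : K), fun y => rfl, ?_⟩
  obtain ⟨n, ρ, rfl⟩ := repClass_surj χ
  rw [RepClass.repClass_res, repClass_eq_iff]
  refine ⟨(Representation.Equiv.mk
    (LinearEquiv.ofLinearMap (ρ ⟨k, hk⟩) (ρ ⟨k, hk⟩⁻¹) ?_ ?_) fun g => ?_).symm⟩
  · rw [← Module.End.mul_eq_comp, ← map_mul]; simp; rfl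
  · rw [← Module.End.mul_eq_comp, ← map_mul]; simp; rfl
  · refine LinearMap.ext fun x => ?_
    have h : ρ ((MulAut.conj (⟨k, hk⟩ : K)) g) * ρ ⟨k, hk⟩ = ρ ⟨k, hk⟩ * ρ g := by
      rw [← map_mul, ← map_mul]; simp [MulAut.conj_apply]
    exact (LinearMap.congr_fun h x).symm

/-- The character triple `(N_G(K)_χ, K, χ)` for `χ ∈ IBr K`; if `K` is normal in `G` this is
`(G_χ, K, χ)`. -/
def inertiaTriple {G : Type v} [Group G] (K : Subgroup G) (χ : RepClass F K) (hχ : χ ∈ IBr F K) :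
    CharTriple F (inertia K χ) where
  N := K.subgroupOf (inertia K χ)
  normal := by
    refine ⟨fun n hn g => ?_⟩
    obtain ⟨f, hf, -⟩ := g.2
    have := (f ⟨n, hn⟩).2
    rw [hf] at this
    exact this
  θ := χ.res ((inertia K χ).subtype.subgroupComap K)
  irreducible := by
    obtain ⟨n, ρ, hρ, rfl⟩ := hχ
    refine ⟨n, ρ.comp ((inertia K (repClass ρ)).subtype.subgroupComap K), ?_, rfl⟩
    have hmem : ∀ k : K, (k : G) ∈ inertia K (repClass ρ) := fun k => le_inertia _ _ k.2
    let e : Subrepresentation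
        (ρ.comp ((inertia K (repClass ρ)).subtype.subgroupComap K) : Representation F _ _) ≃o
        Subrepresentation ρ :=
      { toFun := fun U => ⟨U.toSubmodule, fun k v hv =>
          U.apply_mem_toSubmodule ⟨⟨k, hmem k⟩, k.2⟩ hv⟩
        invFun := fun U => ⟨U.toSubmodule, fun k v hv => U.apply_mem_toSubmodule _ hv⟩
        left_inv := fun _ => rfl
        right_inv := fun _ => rfl
        map_rel_iff' := Iff.rfl }
    exact (OrderIso.isSimpleOrder_iff e).2 hρ
  invariant := by
    refine eq_top_iff.2 fun g _ => ?_
    obtain ⟨f, hf, hf'⟩ := g.2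
    let e : (K.subgroupOf (inertia K χ)) ≃* K := Subgroup.subgroupOfEquivOfLe (le_inertia K χ)
    have he : e.toMonoidHom = (inertia K χ).subtype.subgroupComap K := rfl
    refine ⟨(e.trans f).trans e.symm, fun y => ?_, ?_⟩
    · apply Subtype.ext
      have h : ∀ k : K, (((e.symm k : K.subgroupOf (inertia K χ)) : inertia K χ) : G) = k :=
        fun k => rfl
      rw [MulEquiv.trans_apply, h, MulEquiv.trans_apply, hf]
      rfl
    · rw [← he]
      have h : (χ.res e.toMonoidHom).res ((e.trans f).trans e.symm).toMonoidHom =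
          (χ.res f.toMonoidHom).res e.toMonoidHom := by
        rw [RepClass.res_res, RepClass.res_res]
        rfl
      rw [h, hf']

end Triples

/-!
The two character triples are isomorphic because `χ` and `ψ` extend to projective representations
of `A = G_χ` and of `H = N_G(Y)_ψ` with a common cocycle on `A / X ≃ H / Y`.

*From projective extensions to triples.* If `P` is a projective extension of an irreducible
representation `θ` of `N` to `B`, with a cocycle `c` inflated from `B / N`, then the irreducible
representations of `B` over `θ` are the tensor products `R ⊗ P`, where `R` runs through the
irreducible projective representations of `B / N` with cocycle `c⁻¹`: given `U` over `θ`, take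
`R = Hom_N(V, U)` and the evaluation map `R ⊗ V → U`. By Burnside's theorem the `N`-maps
`W ⊗ V → W' ⊗ V` have the form `g ⊗ 1` and the `N`-submodules of `W ⊗ V` have the form `S ⊗ V`
(`exists_eq_rTensor_of_commute`, `exists_eq_range_rTensor_of_stable`), so isomorphisms and
composition series of `R ⊗ P` are those of `R`. Hence `R ⊗ P ↦ R ⊗ P'` is a well-defined bijection
for two projective extensions with the same cocycle, and it is visibly compatible with restriction
and with multiplication by representations of `B / N`
(`CharTriple.nonempty_iso_of_projective`).

*The projective extensions.* Conjugation maps `A` and `H` to the stabilizers of the restricted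
characters in `Aut([X, X])`. Composing it with the projective representations of the cohomological
condition gives projective representations `P` of `A` and `Q` of `H` whose cocycles agree on `H`.
Since `X = [X, X] Z`, on `x ∈ X` they are `L (x w)` and `M (x w)` for some `w ∈ Z`
(`exists_section_eq_mul`), and `Z` acts on `L` and `M` by the same scalars because `χ` and `ψ` lie
over the same `ν`. So `P` on `X` and `Q` on `Y` are `L` and `M` up to the same scalars. Moreover
`P g` intertwines `L` with its conjugate by `g`: on `X` it does so up to scalars, thus exactly on
`[X, X]` (`mul_eq_mul_of_mem_commutator`), and on `Z` since `Z` is central in `G`. Rescaling by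
means of a transversal of `X` in `A` turns `P` and `Q` into extensions of `L` and `M` with a common
cocycle which is inflated from `A / X` (`exists_normalized_projective`).

*The number of characters.* Clifford's correspondence `StabilizerSetup.encard_IBrOver_eq`, in
arbitrary characteristic, identifies `IBr(G | χ)` with `IBr(G_χ | χ)` and `IBr(N_G(Y) | ψ)` with
`IBr(N_G(Y)_ψ | ψ)`, and the isomorphism of triples identifies these. In the proof of
Clifford's correspondence, an element `e` of the group algebra which is the identity on `θ` and zero
on the conjugates of `θ` not isomorphic to `θ` takes the place of the central idempotent of `θ`,
which need not exist.
-/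

open scoped MonoidAlgebra TensorProduct

/-! ### Irreducible representations and their isomorphism classes -/

section Generic

variable {F : Type*} [Field F] {G : Type*} [Group G]

namespace Representation

variable {V W : Type*} [AddCommGroup V] [Module F V] [AddCommGroup W] [Module F W]

theorem isIrreducible_iff_submodule (ρ : Representation F G V) :
    ρ.IsIrreducible ↔ Nontrivial V ∧
      ∀ U : Submodule F V, (∀ g, ∀ v ∈ U, ρ g v ∈ U) → U = ⊥ ∨ U = ⊤ := by
  constructor
  · intro h
    refine ⟨?_, fun U hU => ?_⟩
    · by_contra hV
      rw [not_nontrivial_iff_subsingleton] at hV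
      exact bot_ne_top (α := Subrepresentation ρ)
        (Subrepresentation.toSubmodule_injective (Subsingleton.elim _ _))
    · rcases eq_bot_or_eq_top (⟨U, fun g v hv => hU g v hv⟩ : Subrepresentation ρ) with h | h
      · exact Or.inl (congrArg Subrepresentation.toSubmodule h)
      · exact Or.inr (congrArg Subrepresentation.toSubmodule h)
  · rintro ⟨hV, h⟩
    refine { exists_pair_ne := ⟨⊥, ⊤, fun h => ?_⟩, eq_bot_or_eq_top := fun U => ?_ }
    · exact bot_ne_top (α := Submodule F V) (congrArg Subrepresentation.toSubmodule h)
    · rcases h U.toSubmodule (fun g v hv => U.apply_mem_toSubmodule g hv) with h | h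
      · exact Or.inl (Subrepresentation.toSubmodule_injective h)
      · exact Or.inr (Subrepresentation.toSubmodule_injective h)

theorem IsIrreducible.nontrivial {ρ : Representation F G V} (h : ρ.IsIrreducible) :
    Nontrivial V :=
  ((isIrreducible_iff_submodule ρ).1 h).1

theorem Equiv.map_apply {ρ : Representation F G V} {σ : Representation F G W} (e : ρ.Equiv σ)
    (g : G) (v : V) : e (ρ g v) = σ g (e v) :=
  LinearMap.congr_fun (e.isIntertwining' g) v

theorem IsIrreducible.of_equiv {ρ : Representation F G V} {σ : Representation F G W}
    (h : ρ.IsIrreducible) (e : ρ.Equiv σ) : σ.IsIrreducible := by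
  rw [isIrreducible_iff_submodule] at h ⊢
  obtain ⟨hV, h⟩ := h
  refine ⟨e.toLinearEquiv.symm.toEquiv.nontrivial, fun U hU => ?_⟩
  have hsurj : Function.Surjective e.toLinearMap := e.toLinearEquiv.surjective
  have hinj := Submodule.comap_injective_of_surjective hsurj
  rcases h (U.comap e.toLinearMap) (fun g v hv => by
    have h1 : e.toLinearMap (ρ g v) = σ g (e.toLinearMap v) := e.map_apply g v
    rw [Submodule.mem_comap] at hv ⊢
    rw [h1]
    exact hU g _ hv) with h | h
  · refine Or.inl (hinj (h.trans ?_))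
    exact (LinearMap.ker_eq_bot.2 e.toLinearEquiv.injective).symm
  · exact Or.inr (hinj (h.trans rfl))

/-- Irreducibility only depends on the image of the group. -/
theorem IsIrreducible.comp_surjective {H : Type*} [Group H] {ρ : Representation F G V}
    (h : ρ.IsIrreducible) {f : H →* G} (hf : Function.Surjective f) :
    IsIrreducible (ρ.comp f : Representation F H V) := by
  rw [isIrreducible_iff_submodule] at h ⊢
  refine ⟨h.1, fun U hU => h.2 U fun g v hv => ?_⟩
  obtain ⟨k, rfl⟩ := hf g
  exact hU k v hv

/-- Jacobson density (Burnside's theorem): the group algebra acts on an irreducible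
representation through all linear endomorphisms. -/
theorem IsIrreducible.asAlgebraHom_surjective [IsAlgClosed F] [Module.Finite F V]
    {ρ : Representation F G V} (h : ρ.IsIrreducible) :
    Function.Surjective ρ.asAlgebraHom := by
  intro φ
  classical
  let b := Module.finBasis F V
  let f : Module.End (Module.End F[G] ρ.asModule) ρ.asModule :=
    { toFun := fun x => ρ.asModuleEquiv.symm (φ (ρ.asModuleEquiv x))
      map_add' := fun x y => by simp
      map_smul' := fun a x => by
        -- by Schur's lemma, `a` is a scalar
        obtain ⟨t, rfl⟩ :=
          (IsSimpleModule.algebraMap_end_bijective_of_isAlgClosed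
            (A := F[G]) (V := ρ.asModule) F).2 a
        have h1 : ∀ y : ρ.asModule,
            (algebraMap F (Module.End F[G] ρ.asModule) t) • y = t • y := fun y => rfl
        simp only [h1, map_smul, RingHom.id_apply] }
  obtain ⟨r, hr⟩ := jacobson_density f (Finset.univ.image fun i => ρ.asModuleEquiv.symm (b i))
  refine ⟨r, b.ext fun i => ?_⟩
  have := hr (ρ.asModuleEquiv.symm (b i)) (by simp)
  exact this.symm

/-- A linear combination of group elements can separate a finite family of irreducible
representations into two parts, provided that no member of the first part is isomorphic to a member
of the second one: it acts as the identity on the first part and as zero on the second. -/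
theorem exists_asAlgebraHom_separating {ι : Type*} [Finite ι] {V : ι → Type*}
    [∀ i, AddCommGroup (V i)] [∀ i, Module F (V i)] [∀ i, Module.Finite F (V i)]
    (ρ : ∀ i, Representation F G (V i)) (hρ : ∀ i, (ρ i).IsIrreducible) (S : Set ι)
    (hS : ∀ i ∈ S, ∀ j ∉ S, IsEmpty ((ρ i).Equiv (ρ j))) :
    ∃ a : F[G], (∀ i ∈ S, (ρ i).asAlgebraHom a = 1) ∧ ∀ i ∉ S, (ρ i).asAlgebraHom a = 0 := by
  classical
  -- the projection of the direct sum to the part in `S` commutes with the module endomorphisms,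
  -- so that the density theorem realizes it, on a basis, by an element of the group algebra
  have := Fintype.ofFinite ι
  let M := Π₀ i, (ρ i).asModule
  have hzero : ∀ i j, (i ∈ S ↔ j ∉ S) → ∀ (g : Module.End F[G] M) (v : (ρ i).asModule),
      g (DFinsupp.single i v) j = 0 := by
    intro i j hij g v
    let g' : (ρ i).asModule →ₗ[F[G]] (ρ j).asModule :=
      (DFinsupp.lapply j).comp (g.comp (DFinsupp.lsingle i))
    have : g' = 0 := by
      rcases LinearMap.bijective_or_eq_zero g' with h | h
      · let e := (IntertwiningMap.equivLinearMapAsModule (ρ i) (ρ j)).symm g'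
        have e' : (ρ i).Equiv (ρ j) := e.ofBijective h
        by_cases hi : i ∈ S
        · exact (hS i hi j (hij.1 hi)).elim e'
        · exact (hS j (by tauto) i hi).elim e'.symm
      · exact h
    exact LinearMap.congr_fun this v
  let f : Module.End (Module.End F[G] M) M :=
    { toFun := DFinsupp.filter (· ∈ S)
      map_add' := fun x y => DFinsupp.filter_add _ x y
      map_smul' := fun g x => by
        simp only [RingHom.id_apply, Module.End.smul_def]
        induction x using DFinsupp.induction with
        | h0 => simp
        | ha i v y _ _ ih =>
          rw [map_add, DFinsupp.filter_add, ih, DFinsupp.filter_add, map_add]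
          congr 1
          rw [DFinsupp.filter_single]
          ext j
          rw [DFinsupp.filter_apply]
          by_cases hi : i ∈ S
          · by_cases hj : j ∈ S
            · simp [hi, hj]
            · simp [hi, hj, hzero i j (by tauto) g v]
          · by_cases hj : j ∈ S
            · simp [hi, hj, hzero i j (by tauto) g v]
            · simp [hi, hj] }
  let b := fun i => Module.finBasis F (V i)
  obtain ⟨a, ha⟩ := jacobson_density f
    (Finset.univ.image fun x : Σ i, Fin (Module.finrank F (V i)) =>
      DFinsupp.single x.1 ((ρ x.1).asModuleEquiv.symm (b x.1 x.2)))
  have key : ∀ i k, f (DFinsupp.single i ((ρ i).asModuleEquiv.symm (b i k))) i =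
      a • ((ρ i).asModuleEquiv.symm (b i k)) := by
    intro i k
    rw [ha (DFinsupp.single i ((ρ i).asModuleEquiv.symm (b i k)))
      (Finset.mem_image.2 ⟨⟨i, k⟩, Finset.mem_univ _, rfl⟩)]
    rw [DFinsupp.smul_apply, DFinsupp.single_eq_same]
  refine ⟨a, fun i hi => (b i).ext fun k => ?_, fun i hi => (b i).ext fun k => ?_⟩
  · refine Eq.trans (key i k).symm ?_
    change DFinsupp.filter (· ∈ S) _ i = _
    rw [DFinsupp.filter_apply, if_pos hi, DFinsupp.single_eq_same]
    rfl
  · refine Eq.trans (key i k).symm ?_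
    change DFinsupp.filter (· ∈ S) _ i = _
    rw [DFinsupp.filter_apply, if_neg hi]
    rfl

theorem IntertwiningMap.map_asAlgebraHom {ρ : Representation F G V} {σ : Representation F G W}
    (f : ρ.IntertwiningMap σ) (a : F[G]) (v : V) :
    f (ρ.asAlgebraHom a v) = σ.asAlgebraHom a (f v) := by
  induction a using MonoidAlgebra.induction_linear with
  | zero => simp
  | add x y hx hy => simp [hx, hy]
  | single g c => simp [f.isIntertwining]

/-- **Schur's lemma**: an endomorphism of an irreducible representation is scalar. -/
theorem IsIrreducible.exists_eq_smul [IsAlgClosed F] [Module.Finite F V]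
    {ρ : Representation F G V} (h : ρ.IsIrreducible) (φ : V →ₗ[F] V)
    (hφ : ∀ g, φ ∘ₗ ρ g = ρ g ∘ₗ φ) : ∃ c : F, φ = c • LinearMap.id := by
  obtain ⟨c, hc⟩ := (IsIrreducible.algebraMap_intertwiningMap_bijective_of_isAlgClosed
    (ρ := ρ)).2 ⟨φ, hφ⟩
  exact ⟨c, (congrArg IntertwiningMap.toLinearMap hc).symm⟩

end Representation

section Classes

variable {V W : Type*} [AddCommGroup V] [Module F V] [Module.Finite F V]
  [AddCommGroup W] [Module F W] [Module.Finite F W]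

theorem repClass_eq_of_equiv {ρ : Representation F G V} {σ : Representation F G W}
    (e : ρ.Equiv σ) : repClass ρ = repClass σ :=
  (repClass_eq_iff ρ σ).2 ⟨e⟩

theorem repClass_mem_IBr_iff (ρ : Representation F G V) :
    repClass ρ ∈ IBr F G ↔ ρ.IsIrreducible := by
  constructor
  · rintro ⟨n, σ, hσ, h⟩
    obtain ⟨e⟩ := (repClass_eq_iff _ _).1 h
    exact hσ.of_equiv e
  · intro h
    exact ⟨_, _, h.of_equiv (transportRepEquiv ρ (Module.finBasis F V).equivFun),
      repClass_eq_of_equiv (transportRepEquiv ρ _).symm⟩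

theorem repClass_isSubOf_iff (σ : Representation F G V) (ρ : Representation F G W) :
    (repClass σ).IsSubOf (repClass ρ) ↔
      ∃ f : σ.IntertwiningMap ρ, Function.Injective f := by
  constructor
  · rintro ⟨m, n, σ', ρ', hσ, hρ, f, hf⟩
    obtain ⟨e⟩ := (repClass_eq_iff _ _).1 hσ
    obtain ⟨e'⟩ := (repClass_eq_iff _ _).1 hρ
    refine ⟨(e'.toIntertwiningMap.comp f).comp e.symm.toIntertwiningMap, ?_⟩
    exact (e'.toLinearEquiv.injective.comp hf).comp e.symm.toLinearEquiv.injective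
  · rintro ⟨f, hf⟩
    let e := transportRepEquiv σ (Module.finBasis F V).equivFun
    let e' := transportRepEquiv ρ (Module.finBasis F W).equivFun
    refine ⟨_, _, _, _, repClass_eq_of_equiv e.symm, repClass_eq_of_equiv e'.symm,
      (e'.toIntertwiningMap.comp f).comp e.symm.toIntertwiningMap, ?_⟩
    exact (e'.toLinearEquiv.injective.comp hf).comp e.symm.toLinearEquiv.injective

theorem repClass_subrepresentation_eq {α : Representation F G V} {β : Representation F G W}
    (U : Submodule F W) (hU : ∀ g, U ≤ U.comap (β g)) (i : α.IntertwiningMap β)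
    (hi : Function.Injective i) (hrange : LinearMap.range i.toLinearMap = U) :
    repClass (β.subrepresentation U hU) = repClass α := by
  subst hrange
  refine (repClass_eq_of_equiv (Representation.Equiv.mk (LinearEquiv.ofInjective i.toLinearMap hi)
    fun g => LinearMap.ext fun v => Subtype.ext ?_)).symm
  exact LinearMap.congr_fun (i.isIntertwining' g) v

theorem repClass_quotient_eq {β : Representation F G V} {γ : Representation F G W}
    (U : Submodule F V) (hU : ∀ g, U ≤ U.comap (β g)) (π : β.IntertwiningMap γ)
    (hπ : Function.Surjective π) (hker : LinearMap.ker π.toLinearMap = U) :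
    repClass (β.quotient U hU) = repClass γ := by
  subst hker
  refine repClass_eq_of_equiv (Representation.Equiv.mk
    (π.toLinearMap.quotKerEquivOfSurjective hπ)
    fun g => LinearMap.ext fun v => ?_)
  obtain ⟨v, rfl⟩ := Submodule.Quotient.mk_surjective _ v
  exact LinearMap.congr_fun (π.isIntertwining' g) v

/-- Extending a composition series by an irreducible quotient, for representations on arbitrary
spaces. -/
theorem RepClass.CompFactors.of_exact {U : Type*} [AddCommGroup U] [Module F U]
    [Module.Finite F U] {α : Representation F G U} {β : Representation F G V}
    {γ : Representation F G W} (i : α.IntertwiningMap β) (π : β.IntertwiningMap γ)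
    (hi : Function.Injective i) (hπ : Function.Surjective π)
    (hex : LinearMap.range i.toLinearMap = LinearMap.ker π.toLinearMap)
    (hγ : γ.IsIrreducible) {m : Multiset (RepClass F G)}
    (hm : RepClass.CompFactors (repClass α) m) :
    RepClass.CompFactors (repClass β) (repClass γ ::ₘ m) := by
  obtain ⟨n, β', ⟨e⟩⟩ : ∃ (n : ℕ) (β' : Representation F G (Fin n → F)), Nonempty (β.Equiv β') :=
    ⟨_, _, ⟨transportRepEquiv β (Module.finBasis F V).equivFun⟩⟩
  let j := e.toIntertwiningMap.comp i
  let ϖ := π.comp e.symm.toIntertwiningMap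
  have hj : Function.Injective j := e.toLinearEquiv.injective.comp hi
  have hϖ : Function.Surjective ϖ := hπ.comp e.symm.toLinearEquiv.surjective
  have hU := ϖ.ker.apply_mem_toSubmodule
  have hrange : LinearMap.range j.toLinearMap = LinearMap.ker ϖ.toLinearMap := by
    ext x
    obtain ⟨y, rfl⟩ := e.toLinearEquiv.surjective x
    have h1 : ϖ.toLinearMap (e.toLinearEquiv y) = π.toLinearMap y :=
      congrArg π (e.symm_apply_apply y)
    rw [LinearMap.mem_ker, h1, ← LinearMap.mem_ker, ← hex]
    constructor
    · rintro ⟨z, hz⟩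
      exact ⟨z, e.toLinearEquiv.injective hz⟩
    · rintro ⟨z, rfl⟩
      exact ⟨z, rfl⟩
  rw [repClass_eq_of_equiv e, ← repClass_quotient_eq _ hU ϖ hϖ rfl]
  refine RepClass.CompFactors.cons _ _ _ ?_ _ ?_
  · rw [← repClass_mem_IBr_iff, repClass_quotient_eq _ hU ϖ hϖ rfl, repClass_mem_IBr_iff]
    exact hγ
  · rw [repClass_subrepresentation_eq _ hU j hj hrange]
    exact hm

theorem RepClass.CompFactors.zero_of_subsingleton [Subsingleton V] (ρ : Representation F G V) :
    RepClass.CompFactors (repClass ρ) 0 := by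
  let ρ₀ : Representation F G (Fin 0 → F) := 1
  have : repClass ρ = repClass ρ₀ := repClass_eq_of_equiv
    (Representation.Equiv.mk (0 : V ≃ₗ[F] (Fin 0 → F)) fun g => LinearMap.ext fun v =>
      Subsingleton.elim _ _)
  rw [this]
  exact RepClass.CompFactors.zero ρ₀

end Classes

end Generic

/-! ### Subspaces and maps which are stable under an irreducible tensor factor -/

section TensorStable

variable {F : Type*} [Field F] {N : Type*} [Group N] {V W W' : Type*}
  [AddCommGroup V] [Module F V] [AddCommGroup W] [Module F W] [AddCommGroup W'] [Module F W']

/-- The representation on `W ⊗ V` through the second factor. -/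
noncomputable def rightRep (W : Type*) [AddCommGroup W] [Module F W] (θ : Representation F N V) :
    Representation F N (W ⊗[F] V) where
  toFun n := LinearMap.lTensor W (θ n)
  map_one' := by simp [Module.End.one_eq_id]
  map_mul' g h := by simp [LinearMap.lTensor_mul]

theorem rightRep_asAlgebraHom (θ : Representation F N V) (a : F[N]) :
    (rightRep W θ).asAlgebraHom a = LinearMap.lTensor W (θ.asAlgebraHom a) := by
  induction a using MonoidAlgebra.induction_linear with
  | zero => simp
  | add x y hx hy => simp [hx, hy, LinearMap.lTensor_add]
  | single g c => simp [rightRep, LinearMap.lTensor_smul]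

theorem mem_of_tmul_mem_range_rTensor {U : Submodule F W} {w : W} {v : V} (hv : v ≠ 0)
    (h : w ⊗ₜ[F] v ∈ LinearMap.range (U.subtype.rTensor V)) : w ∈ U := by
  rw [← rTensor_mkQ, LinearMap.mem_ker, LinearMap.rTensor_tmul] at h
  obtain ⟨l, hl⟩ := Module.Projective.exists_dual_ne_zero F hv
  have := congrArg (TensorProduct.rid F (W ⧸ U) ∘ LinearMap.lTensor (W ⧸ U) l) h
  simpa [hl] using this

theorem eq_zero_of_tmul_eq_zero {w : W} {v : V} (hv : v ≠ 0) (h : w ⊗ₜ[F] v = 0) : w = 0 := by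
  refine (Submodule.mem_bot F).1 (mem_of_tmul_mem_range_rTensor (U := ⊥) hv ?_)
  rw [h]
  exact Submodule.zero_mem _

theorem eq_zero_of_tmul_eq_zero' {w : W} {v : V} (hw : w ≠ 0) (h : w ⊗ₜ[F] v = 0) : v = 0 :=
  eq_zero_of_tmul_eq_zero (F := F) hw (by simpa using congrArg (TensorProduct.comm F W V) h)

variable [IsAlgClosed F] [Module.Finite F V] {θ : Representation F N V}

/-- A subspace of `W ⊗ V` which is stable under an irreducible action on `V` has the form
`U ⊗ V`. -/
theorem exists_eq_range_rTensor_of_stable (hθ : θ.IsIrreducible) (K : Submodule F (W ⊗[F] V))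
    (hK : ∀ n, ∀ x ∈ K, LinearMap.lTensor W (θ n) x ∈ K) :
    ∃ U : Submodule F W, K = LinearMap.range (U.subtype.rTensor V) := by
  have hK' : ∀ φ : Module.End F V, ∀ x ∈ K, LinearMap.lTensor W φ x ∈ K := by
    intro φ x hx
    obtain ⟨a, rfl⟩ := hθ.asAlgebraHom_surjective φ
    rw [← rightRep_asAlgebraHom]
    exact Representation.asAlgebraHom_mem_of_forall_mem (rightRep W θ) K hK x hx a
  let U : Submodule F W :=
    { carrier := {w | ∀ v, w ⊗ₜ[F] v ∈ K}
      add_mem' := fun ha hb v => by rw [TensorProduct.add_tmul]; exact K.add_mem (ha v) (hb v)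
      zero_mem' := fun v => by rw [TensorProduct.zero_tmul]; exact K.zero_mem
      smul_mem' := fun c w hw v => by rw [← TensorProduct.smul_tmul']; exact K.smul_mem c (hw v) }
  refine ⟨U, le_antisymm (fun x hx => ?_) ?_⟩
  · let b := Module.finBasis F V
    obtain ⟨w, rfl⟩ := TensorProduct.eq_repr_basis_right b x
    refine Submodule.sum_mem _ fun k _ => ?_
    refine ⟨(⟨w k, fun v => ?_⟩ : U) ⊗ₜ b k, rfl⟩
    -- the endomorphism which maps `b k` to `v` and kills the other basis vectors extracts `w k`
    have h := hK' (b.constr F fun l => if l = k then v else 0) _ hx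
    rw [map_finsuppSum] at h
    simp only [LinearMap.lTensor_tmul, Module.Basis.constr_basis] at h
    rw [Finsupp.sum, Finset.sum_eq_single k] at h
    · simpa using h
    · intro l _ hl
      simp [hl]
    · intro hk
      simp [Finsupp.notMem_support_iff.1 hk]
  · rintro _ ⟨x, rfl⟩
    induction x using TensorProduct.induction_on with
    | zero => simp
    | add x y hx hy => rw [map_add]; exact K.add_mem hx hy
    | tmul u v => exact u.2 v

/-- A linear map `W ⊗ V → W' ⊗ V` which commutes with an irreducible action on `V` has the form
`g ⊗ 1`. -/
theorem exists_eq_rTensor_of_commute (hθ : θ.IsIrreducible) (f : W ⊗[F] V →ₗ[F] W' ⊗[F] V)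
    (hf : ∀ n x, f (LinearMap.lTensor W (θ n) x) = LinearMap.lTensor W' (θ n) (f x)) :
    ∃ g : W →ₗ[F] W', f = g.rTensor V := by
  have hf' : ∀ (φ : Module.End F V) x,
      f (LinearMap.lTensor W φ x) = LinearMap.lTensor W' φ (f x) := by
    intro φ x
    obtain ⟨a, rfl⟩ := hθ.asAlgebraHom_surjective φ
    rw [← rightRep_asAlgebraHom, ← rightRep_asAlgebraHom]
    exact Representation.IntertwiningMap.map_asAlgebraHom
      (ρ := rightRep W θ) (σ := rightRep W' θ)
      ⟨f, fun n => LinearMap.ext fun x => hf n x⟩ a x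
  have hV : Nontrivial V := ((Representation.isIrreducible_iff_submodule θ).1 hθ).1
  obtain ⟨v₀, hv₀⟩ := exists_ne (0 : V)
  obtain ⟨l, hl⟩ := Module.Projective.exists_dual_ne_zero F hv₀
  let l' := (l v₀)⁻¹ • l
  have hl' : l' v₀ = 1 := by simp [l', hl]
  refine ⟨(TensorProduct.rid F W').toLinearMap ∘ₗ LinearMap.lTensor W' l' ∘ₗ f ∘ₗ
    (TensorProduct.mk F W V).flip v₀, TensorProduct.ext' fun w v => ?_⟩
  have h1 : w ⊗ₜ[F] v = LinearMap.lTensor W (l'.smulRight v) (w ⊗ₜ[F] v₀) := by simp [hl']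
  rw [h1, hf', LinearMap.lTensor_tmul, LinearMap.smulRight_apply, hl', one_smul,
    LinearMap.rTensor_tmul]
  generalize hy : f (w ⊗ₜ[F] v₀) = y
  simp only [LinearMap.comp_apply, LinearMap.flip_apply, TensorProduct.mk_apply, hy]
  clear hy
  induction y using TensorProduct.induction_on with
  | zero => simp
  | add x y hx hy => simp only [map_add, TensorProduct.add_tmul, hx, hy]
  | tmul a b => simp [TensorProduct.smul_tmul]

end TensorStable

/-! ### Products of projective representations and the resulting correspondence -/

section Twisted

variable {F : Type u} [Field F]

/-- A projective representation of `Q` on `W` whose cocycle is the inverse of `c`. -/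
structure TwistedRep {Q : Type*} [Group Q] (c : Q → Q → Fˣ) (W : Type*) [AddCommGroup W]
    [Module F W] where
  toFun : Q → Module.End F W
  map_one : toFun 1 = 1
  map_mul : ∀ q r, toFun q * toFun r = (((c q r)⁻¹ : Fˣ) : F) • toFun (q * r)

/-- An extension of the representation `θ` of `N` to a projective representation of `B`, where
`1 → N → B → Q → 1` is exact and where the cocycle is inflated from the function `c` on `Q`. -/
structure ProjExtension {B N Q : Type*} [Group B] [Group N] [Group Q] (c : Q → Q → Fˣ)
    (i : N →* B) (p : B →* Q) {V : Type*} [AddCommGroup V] [Module F V]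
    (θ : Representation F N V) where
  toFun : B → Module.End F V
  map_mul : ∀ g h, toFun g * toFun h = (c (p g) (p h) : F) • toFun (g * h)
  map_incl : ∀ n, toFun (i n) = θ n
  mem_range_iff : ∀ b, b ∈ i.range ↔ p b = 1
  surjective : Function.Surjective p

variable {B N Q : Type*} [Group B] [Group N] [Group Q] {c : Q → Q → Fˣ}
  {i : N →* B} {p : B →* Q} {V : Type*} [AddCommGroup V] [Module F V]
  {θ : Representation F N V} {W W' : Type*} [AddCommGroup W] [Module F W]
  [AddCommGroup W'] [Module F W']

namespace TwistedRep

/-- Irreducibility of a projective representation. -/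
def IsIrreducible (R : TwistedRep c W) : Prop :=
  Nontrivial W ∧ ∀ U : Submodule F W, (∀ q, ∀ w ∈ U, R.toFun q w ∈ U) → U = ⊥ ∨ U = ⊤

/-- The restriction of a projective representation to an invariant subspace. -/
def sub (R : TwistedRep c W) (U : Submodule F W) (hU : ∀ q, ∀ w ∈ U, R.toFun q w ∈ U) :
    TwistedRep c U where
  toFun q := (R.toFun q).restrict (hU q)
  map_one := by ext w; simp [R.map_one]
  map_mul q r := by
    ext w
    exact LinearMap.congr_fun (R.map_mul q r) w

/-- The action of a projective representation on the quotient by an invariant subspace. -/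
def quot (R : TwistedRep c W) (U : Submodule F W) (hU : ∀ q, ∀ w ∈ U, R.toFun q w ∈ U) :
    TwistedRep c (W ⧸ U) where
  toFun q := U.mapQ U (R.toFun q) (hU q)
  map_one := by ext w; simp [R.map_one]
  map_mul q r := by
    ext w
    exact congrArg U.mkQ (LinearMap.congr_fun (R.map_mul q r) w)

/-- Transport of a projective representation along a linear isomorphism. -/
def transport (R : TwistedRep c W) (e : W ≃ₗ[F] W') : TwistedRep c W' where
  toFun q := e.conj (R.toFun q)
  map_one := by ext; simp [R.map_one]
  map_mul q r := by
    ext w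
    have := LinearMap.congr_fun (R.map_mul q r) (e.symm w)
    simp only [Module.End.mul_apply, LinearMap.smul_apply] at this
    simp [this]

/-- The tensor product of a representation and a projective representation. -/
noncomputable def tensorRep (R : TwistedRep c W) (β : Representation F Q W') :
    TwistedRep c (W' ⊗[F] W) where
  toFun q := TensorProduct.map (β q) (R.toFun q)
  map_one := by simp [R.map_one]
  map_mul q r := by
    rw [← TensorProduct.map_mul, R.map_mul, ← _root_.map_mul, TensorProduct.map_smul_right]

/-- The restriction of a projective representation along a homomorphism. -/
def comp {Q' : Type*} [Group Q'] (R : TwistedRep c W) (f : Q' →* Q) :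
    TwistedRep (fun a b => c (f a) (f b)) W where
  toFun q := R.toFun (f q)
  map_one := by rw [_root_.map_one, R.map_one]
  map_mul q r := by rw [R.map_mul, ← f.map_mul]

end TwistedRep

namespace ProjExtension

section Basic

variable (P : ProjExtension c i p θ)

theorem map_one : P.toFun 1 = 1 := by
  rw [← _root_.map_one i, P.map_incl, _root_.map_one]

theorem apply_incl (P : ProjExtension c i p θ) (n : N) : p (i n) = 1 :=
  (P.mem_range_iff _).1 ⟨n, rfl⟩

theorem mul_inv_apply (g : B) : P.toFun g * P.toFun g⁻¹ = (c (p g) (p g⁻¹) : F) • 1 := by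
  rw [P.map_mul, mul_inv_cancel, P.map_one]

theorem isUnit (g : B) : IsUnit (P.toFun g) := by
  have h1 : P.toFun g * (((c (p g) (p g⁻¹))⁻¹ : Fˣ) • P.toFun g⁻¹) = 1 := by
    rw [mul_smul_comm, P.mul_inv_apply, Units.smul_def, smul_smul, Units.inv_mul, one_smul]
  have h2 : (((c (p g⁻¹) (p g))⁻¹ : Fˣ) • P.toFun g⁻¹) * P.toFun g = 1 := by
    have := P.mul_inv_apply g⁻¹
    rw [inv_inv] at this
    rw [smul_mul_assoc, this, Units.smul_def, smul_smul, Units.inv_mul, one_smul]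
  exact isUnit_iff_exists_and_exists.2 ⟨⟨_, h1⟩, ⟨_, h2⟩⟩

theorem apply_ne_zero (g : B) {v : V} (hv : v ≠ 0) : P.toFun g v ≠ 0 := by
  intro h0
  obtain ⟨u, hu⟩ := P.isUnit g
  apply hv
  have := congrArg (↑u⁻¹ : Module.End F V) h0
  rwa [← hu, ← Module.End.mul_apply, Units.inv_mul, Module.End.one_apply, _root_.map_zero] at this

theorem cocycle_one_right (P : ProjExtension c i p θ) [Nontrivial V] (q : Q) : c q 1 = 1 := by
  obtain ⟨g, rfl⟩ := P.surjective q
  have h := P.map_mul g 1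
  rw [P.map_one, mul_one, mul_one, _root_.map_one] at h
  obtain ⟨v, hv⟩ := exists_ne (0 : V)
  refine Units.ext (smul_left_injective F (P.apply_ne_zero g hv) ?_)
  have h2 := LinearMap.congr_fun h v
  rw [LinearMap.smul_apply] at h2
  simp only [Units.val_one, one_smul]
  exact h2.symm

theorem cocycle_one_left (P : ProjExtension c i p θ) [Nontrivial V] (q : Q) : c 1 q = 1 := by
  obtain ⟨g, rfl⟩ := P.surjective q
  have h := P.map_mul 1 g
  rw [P.map_one, one_mul, one_mul, _root_.map_one] at h
  obtain ⟨v, hv⟩ := exists_ne (0 : V)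
  refine Units.ext (smul_left_injective F (P.apply_ne_zero g hv) ?_)
  have h2 := LinearMap.congr_fun h v
  rw [LinearMap.smul_apply] at h2
  simp only [Units.val_one, one_smul]
  exact h2.symm

/-- The representation `R ⊗ P` of `B`: the cocycles of the two factors cancel. -/
noncomputable def mulRep (R : TwistedRep c W) : Representation F B (W ⊗[F] V) where
  toFun g := TensorProduct.map (R.toFun (p g)) (P.toFun g)
  map_one' := by rw [_root_.map_one, R.map_one, P.map_one, TensorProduct.map_one]
  map_mul' g h := by
    rw [← TensorProduct.map_mul, R.map_mul, P.map_mul, TensorProduct.map_smul_left,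
      TensorProduct.map_smul_right, smul_smul, Units.inv_mul, one_smul, _root_.map_mul]

theorem mulRep_tmul (R : TwistedRep c W) (g : B) (w : W) (v : V) :
    P.mulRep R g (w ⊗ₜ v) = R.toFun (p g) w ⊗ₜ P.toFun g v := rfl

theorem mulRep_incl (R : TwistedRep c W) (n : N) :
    P.mulRep R (i n) = LinearMap.lTensor W (θ n) := by
  change TensorProduct.map (R.toFun (p (i n))) (P.toFun (i n)) = _
  rw [P.apply_incl, R.map_one, P.map_incl]
  rfl

/-- Functoriality of `R ↦ R ⊗ P`. -/
noncomputable def mulMap {R : TwistedRep c W} {R' : TwistedRep c W'} (f : W →ₗ[F] W')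
    (hf : ∀ q w, f (R.toFun q w) = R'.toFun q (f w)) :
    (P.mulRep R).IntertwiningMap (P.mulRep R') where
  toLinearMap := f.rTensor V
  isIntertwining' g := TensorProduct.ext' fun w v => by
    simp [mulRep_tmul, hf]

theorem repClass_mulRep_eq [Module.Finite F V] [Module.Finite F W] [Module.Finite F W']
    {R : TwistedRep c W} {R' : TwistedRep c W'}
    (e : W ≃ₗ[F] W') (he : ∀ q w, e (R.toFun q w) = R'.toFun q (e w)) :
    repClass (P.mulRep R) = repClass (P.mulRep R') :=
  repClass_eq_of_equiv (Representation.Equiv.mk (TensorProduct.congr e (LinearEquiv.refl F V))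
    fun g => TensorProduct.ext' fun w v => by simp [mulRep_tmul, he])

end Basic

section Irreducible

variable [IsAlgClosed F] [Module.Finite F V] (P : ProjExtension c i p θ)

/-- The invariant subspaces of `R ⊗ P` are the `U ⊗ V` for the invariant subspaces `U` of `R`. -/
theorem exists_sub_of_stable (hθ : θ.IsIrreducible) (R : TwistedRep c W)
    (K : Submodule F (W ⊗[F] V)) (hK : ∀ g, ∀ x ∈ K, P.mulRep R g x ∈ K) :
    ∃ U : Submodule F W, (∀ q, ∀ w ∈ U, R.toFun q w ∈ U) ∧
      K = LinearMap.range (U.subtype.rTensor V) := by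
  obtain ⟨U, rfl⟩ := exists_eq_range_rTensor_of_stable hθ K fun n x hx => by
    rw [← P.mulRep_incl R]
    exact hK _ x hx
  refine ⟨U, fun q w hw => ?_, rfl⟩
  have := hθ.nontrivial
  obtain ⟨v, hv⟩ := exists_ne (0 : V)
  obtain ⟨g, rfl⟩ := P.surjective q
  have h := hK g (w ⊗ₜ v) ⟨(⟨w, hw⟩ : U) ⊗ₜ v, rfl⟩
  rw [mulRep_tmul] at h
  exact mem_of_tmul_mem_range_rTensor (P.apply_ne_zero g hv) h

theorem isIrreducible_mulRep_iff (hθ : θ.IsIrreducible) (R : TwistedRep c W) :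
    (P.mulRep R).IsIrreducible ↔ R.IsIrreducible := by
  have := hθ.nontrivial
  obtain ⟨v, hv⟩ := exists_ne (0 : V)
  rw [Representation.isIrreducible_iff_submodule]
  constructor
  · rintro ⟨hn, h⟩
    refine ⟨?_, fun U hU => ?_⟩
    · by_contra hW
      rw [not_nontrivial_iff_subsingleton] at hW
      exact not_subsingleton (W ⊗[F] V) inferInstance
    · rcases h (LinearMap.range (U.subtype.rTensor V))
        (P.mulMap (R := R.sub U hU) (R' := R) U.subtype fun _ _ => rfl).range.apply_mem_toSubmodule
        with h | h
      · left
        rw [Submodule.eq_bot_iff]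
        intro w hw
        have h1 : w ⊗ₜ[F] v ∈ LinearMap.range (U.subtype.rTensor V) :=
          ⟨(⟨w, hw⟩ : U) ⊗ₜ v, rfl⟩
        rw [h] at h1
        refine (Submodule.mem_bot F).1 (mem_of_tmul_mem_range_rTensor (U := ⊥) hv ?_)
        rw [(Submodule.mem_bot F).1 h1]
        exact Submodule.zero_mem _
      · right
        rw [eq_top_iff]
        intro w _
        exact mem_of_tmul_mem_range_rTensor hv (h ▸ Submodule.mem_top)
  · rintro ⟨hn, h⟩
    refine ⟨?_, fun K hK => ?_⟩
    · infer_instance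
    · obtain ⟨U, hU, rfl⟩ := P.exists_sub_of_stable hθ R K hK
      rcases h U hU with rfl | rfl
      · left
        rw [Submodule.eq_bot_iff]
        rintro _ ⟨x, rfl⟩
        rw [Subsingleton.elim x 0, _root_.map_zero]
      · right
        rw [LinearMap.range_eq_top]
        exact LinearMap.rTensor_surjective _ fun w => ⟨⟨w, Submodule.mem_top⟩, rfl⟩

/-- The intertwining maps between `R ⊗ P` and `R' ⊗ P` have the form `g ⊗ 1`. -/
theorem exists_eq_rTensor (hθ : θ.IsIrreducible) {R : TwistedRep c W} {R' : TwistedRep c W'}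
    (f : (P.mulRep R).IntertwiningMap (P.mulRep R')) :
    ∃ g : W →ₗ[F] W', f.toLinearMap = g.rTensor V := by
  refine exists_eq_rTensor_of_commute hθ f.toLinearMap fun n x => ?_
  rw [← P.mulRep_incl R, ← P.mulRep_incl R']
  exact f.isIntertwining _ _ _ _

/-- An isomorphism `R ⊗ P ≃ R' ⊗ P` comes from an isomorphism `R ≃ R'`. -/
theorem exists_equiv_of_repClass_eq (hθ : θ.IsIrreducible) [Module.Finite F W]
    [Module.Finite F W'] {R : TwistedRep c W} {R' : TwistedRep c W'}
    (h : repClass (P.mulRep R) = repClass (P.mulRep R')) :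
    ∃ e : W ≃ₗ[F] W', ∀ q w, e (R.toFun q w) = R'.toFun q (e w) := by
  have := hθ.nontrivial
  obtain ⟨v, hv⟩ := exists_ne (0 : V)
  obtain ⟨e⟩ := (repClass_eq_iff _ _).1 h
  obtain ⟨f, hf⟩ := P.exists_eq_rTensor hθ e.toIntertwiningMap
  obtain ⟨g, hg⟩ := P.exists_eq_rTensor hθ e.symm.toIntertwiningMap
  have hf' : ∀ w v, e (w ⊗ₜ v) = f w ⊗ₜ v := fun w v => LinearMap.congr_fun hf (w ⊗ₜ v)
  have hg' : ∀ w v, e.symm (w ⊗ₜ v) = g w ⊗ₜ v := fun w v => LinearMap.congr_fun hg (w ⊗ₜ v)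
  have hgf : ∀ w, g (f w) = w := fun w => by
    refine sub_eq_zero.1 (eq_zero_of_tmul_eq_zero (F := F) hv ?_)
    rw [TensorProduct.sub_tmul, ← hg', ← hf', e.symm_apply_apply, sub_self]
  have hfg : ∀ w, f (g w) = w := fun w => by
    refine sub_eq_zero.1 (eq_zero_of_tmul_eq_zero (F := F) hv ?_)
    rw [TensorProduct.sub_tmul, ← hf', ← hg', e.apply_symm_apply, sub_self]
  refine ⟨LinearEquiv.ofLinearMap f g (LinearMap.ext hfg) (LinearMap.ext hgf), fun q w => ?_⟩
  obtain ⟨x, rfl⟩ := P.surjective q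
  refine sub_eq_zero.1 (eq_zero_of_tmul_eq_zero (F := F) (P.apply_ne_zero x hv) ?_)
  rw [TensorProduct.sub_tmul, sub_eq_zero]
  have h1 := e.map_apply x (w ⊗ₜ v)
  rw [mulRep_tmul, hf', hf', mulRep_tmul] at h1
  exact h1

/-- It suffices to test injectivity of an intertwining map on pure tensors, since its kernel has the
form `S ⊗ V`. -/
theorem injective_of_forall_tmul (hθ : θ.IsIrreducible) {U : Type*} [AddCommGroup U] [Module F U]
    {ρ : Representation F B U} {R : TwistedRep c W} (E : (P.mulRep R).IntertwiningMap ρ)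
    (hE : ∀ w, (∀ v, E (w ⊗ₜ v) = 0) → w = 0) : Function.Injective E := by
  refine (injective_iff_map_eq_zero E.toLinearMap).2 fun x hx => ?_
  obtain ⟨S, -, hS⟩ := P.exists_sub_of_stable hθ _ _ E.ker.apply_mem_toSubmodule
  change LinearMap.ker E.toLinearMap = _ at hS
  have hS' : S = ⊥ := by
    rw [Submodule.eq_bot_iff]
    refine fun w hw => hE w fun v => ?_
    have h1 : w ⊗ₜ v ∈ LinearMap.ker E.toLinearMap := hS ▸ ⟨(⟨w, hw⟩ : S) ⊗ₜ v, rfl⟩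
    exact h1
  rw [← LinearMap.mem_ker, hS, hS'] at hx
  obtain ⟨y, rfl⟩ := hx
  rw [Subsingleton.elim y 0, _root_.map_zero]

end Irreducible

/-- The conjugation action of `B` on `Hom(V, U)`, where `B` acts on `U` by `ρ` and on `V`
projectively by `P`. -/
noncomputable def homAct {U : Type*} [AddCommGroup U] [Module F U] (P : ProjExtension c i p θ)
    (ρ : Representation F B U) (g : B) : Module.End F (V →ₗ[F] U) where
  toFun f := ρ g ∘ₗ f ∘ₗ (↑((P.isUnit g).unit⁻¹) : Module.End F V)
  map_add' f f' := by rw [LinearMap.add_comp, LinearMap.comp_add]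
  map_smul' a f := by rw [LinearMap.smul_comp, LinearMap.comp_smul, RingHom.id_apply]

section HomAct

variable (P : ProjExtension c i p θ) {U : Type*} [AddCommGroup U] [Module F U]
  (ρ : Representation F B U)

theorem homAct_apply_apply (g : B) (f : V →ₗ[F] U) (v : V) :
    P.homAct ρ g f (P.toFun g v) = ρ g (f v) := by
  have h : (↑((P.isUnit g).unit⁻¹) : Module.End F V) (P.toFun g v) = v :=
    LinearMap.congr_fun (P.isUnit g).val_inv_mul v
  change ρ g (f _) = _
  rw [h]

theorem toFun_surjective (g : B) : Function.Surjective (P.toFun g) := fun v =>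
  ⟨(↑((P.isUnit g).unit⁻¹) : Module.End F V) v, LinearMap.congr_fun (P.isUnit g).mul_val_inv v⟩

theorem homAct_eq_iff (g : B) (f f' : V →ₗ[F] U) :
    P.homAct ρ g f = f' ↔ ∀ v, ρ g (f v) = f' (P.toFun g v) := by
  constructor
  · rintro rfl v
    rw [homAct_apply_apply]
  · intro h
    ext v
    obtain ⟨v, rfl⟩ := P.toFun_surjective g v
    rw [homAct_apply_apply, h]

theorem homAct_mul (g h : B) (f : V →ₗ[F] U) :
    P.homAct ρ g (P.homAct ρ h f) = (((c (p g) (p h))⁻¹ : Fˣ) : F) • P.homAct ρ (g * h) f := by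
  rw [homAct_eq_iff]
  intro v
  obtain ⟨v, rfl⟩ := P.toFun_surjective h v
  rw [homAct_apply_apply]
  have h1 := LinearMap.congr_fun (P.map_mul g h) v
  rw [Module.End.mul_apply] at h1
  rw [h1, LinearMap.smul_apply, LinearMap.smul_apply, _root_.map_smul, smul_smul, Units.inv_mul,
    one_smul, homAct_apply_apply, _root_.map_mul, Module.End.mul_apply]

/-- The space of the `N`-equivariant maps from `V` to `U`. -/
noncomputable def homInv : Submodule F (V →ₗ[F] U) :=
  ⨅ n, LinearMap.eqLocus (P.homAct ρ (i n)) LinearMap.id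

theorem mem_homInv {f : V →ₗ[F] U} :
    f ∈ P.homInv ρ ↔ ∀ n, P.homAct ρ (i n) f = f := by
  simp [homInv]

/-- On `N`-equivariant maps, the action of `B` only depends on the image in `Q`. -/
theorem homAct_eq_of_proj_eq (hθ : θ.IsIrreducible) {f : V →ₗ[F] U} (hf : f ∈ P.homInv ρ)
    {g g' : B} (h : p g = p g') : P.homAct ρ g f = P.homAct ρ g' f := by
  have := hθ.nontrivial
  obtain ⟨n, hn⟩ := (P.mem_range_iff (g⁻¹ * g')).2 (by simp [h])
  have h1 := P.homAct_mul ρ g (i n) f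
  rw [(P.mem_homInv ρ).1 hf, P.apply_incl, P.cocycle_one_right, inv_one, Units.val_one, one_smul,
    hn, mul_inv_cancel_left] at h1
  exact h1

theorem homAct_mem_homInv (hθ : θ.IsIrreducible) {f : V →ₗ[F] U} (hf : f ∈ P.homInv ρ) (g : B) :
    P.homAct ρ g f ∈ P.homInv ρ := by
  have := hθ.nontrivial
  rw [mem_homInv]
  intro n
  rw [homAct_mul, P.apply_incl, P.cocycle_one_left, inv_one, Units.val_one, one_smul]
  exact P.homAct_eq_of_proj_eq ρ hθ hf (by rw [_root_.map_mul, P.apply_incl, one_mul])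

/-- The projective representation of `Q` on the space of `N`-equivariant maps `V → U`. -/
noncomputable def homRep (hθ : θ.IsIrreducible) : TwistedRep c (P.homInv ρ) where
  toFun q := (P.homAct ρ (Function.surjInv P.surjective q)).restrict fun _ hf =>
    P.homAct_mem_homInv ρ hθ hf _
  map_one := by
    ext f : 2
    change P.homAct ρ _ f.1 = f.1
    rw [P.homAct_eq_of_proj_eq ρ hθ f.2 (g' := 1)
      (by rw [Function.surjInv_eq P.surjective, _root_.map_one]), homAct_eq_iff]
    intro v
    rw [P.map_one, _root_.map_one]
    rfl
  map_mul q r := by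
    ext f : 2
    change P.homAct ρ _ (P.homAct ρ _ f.1) = _ • P.homAct ρ _ f.1
    rw [homAct_mul, Function.surjInv_eq P.surjective, Function.surjInv_eq P.surjective]
    congr 1
    refine P.homAct_eq_of_proj_eq ρ hθ f.2 ?_
    rw [_root_.map_mul, Function.surjInv_eq P.surjective, Function.surjInv_eq P.surjective,
      Function.surjInv_eq P.surjective]

theorem homRep_apply (hθ : θ.IsIrreducible) (g : B) (f : P.homInv ρ) :
    ((P.homRep ρ hθ).toFun (p g) f : V →ₗ[F] U) = P.homAct ρ g f :=
  P.homAct_eq_of_proj_eq ρ hθ f.2 (Function.surjInv_eq _ _)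

/-- The evaluation map `Hom_N(V, U) ⊗ V → U`. -/
noncomputable def evalMap (hθ : θ.IsIrreducible) :
    (P.mulRep (P.homRep ρ hθ)).IntertwiningMap ρ where
  toLinearMap := TensorProduct.lift (P.homInv ρ).subtype
  isIntertwining' g := TensorProduct.ext' fun f v => by
    rw [LinearMap.comp_apply, mulRep_tmul, LinearMap.comp_apply, TensorProduct.lift.tmul,
      TensorProduct.lift.tmul, Submodule.subtype_apply, Submodule.subtype_apply, homRep_apply,
      homAct_apply_apply]

/-- An irreducible representation of `B` lying over `θ` has the form `R ⊗ P`. -/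
theorem exists_repClass_mulRep_eq [IsAlgClosed F] [Module.Finite F V] [Module.Finite F U]
    (hθ : θ.IsIrreducible) {ρ : Representation F B U} (hρ : ρ.IsIrreducible)
    (f : θ.IntertwiningMap (ρ.comp i : Representation F N U)) (hf : Function.Injective f) :
    ∃ (k : ℕ) (R : TwistedRep c (Fin k → F)), repClass (P.mulRep R) = repClass ρ := by
  have := hθ.nontrivial
  have hmem : f.toLinearMap ∈ P.homInv ρ := by
    rw [mem_homInv]
    intro n
    rw [homAct_eq_iff]
    intro v
    rw [P.map_incl]
    exact (LinearMap.congr_fun (f.isIntertwining' n) v).symm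
  let E := P.evalMap ρ hθ
  have hE : ∀ φ v, E.toLinearMap (φ ⊗ₜ v) = φ.1 v := fun _ _ => TensorProduct.lift.tmul _ _
  have hsurj : Function.Surjective E.toLinearMap := by
    rw [← LinearMap.range_eq_top]
    rcases ((Representation.isIrreducible_iff_submodule ρ).1 hρ).2 _
      E.range.apply_mem_toSubmodule with h | h
    · exfalso
      obtain ⟨v, hv⟩ := exists_ne (0 : V)
      have h1 : f v ∈ LinearMap.range E.toLinearMap := ⟨⟨_, hmem⟩ ⊗ₜ v, hE _ _⟩
      change f v ∈ E.range.toSubmodule at h1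
      rw [h, Submodule.mem_bot] at h1
      exact hv (hf (h1.trans (_root_.map_zero f.toLinearMap).symm))
    · exact h
  have hinj : Function.Injective E.toLinearMap :=
    P.injective_of_forall_tmul hθ E fun φ hφ => by
      ext v
      exact (hE φ v).symm.trans (hφ v)
  refine ⟨_, (P.homRep ρ hθ).transport (Module.finBasis F (P.homInv ρ)).equivFun, ?_⟩
  rw [← P.repClass_mulRep_eq (R := P.homRep ρ hθ) (Module.finBasis F (P.homInv ρ)).equivFun]
  · exact repClass_eq_of_equiv (Representation.Equiv.mk
      (LinearEquiv.ofBijective E.toLinearMap ⟨hinj, hsurj⟩) E.isIntertwining')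
  · intro q w
    simp [TwistedRep.transport]

end HomAct

section Correspondence

variable {B' N' : Type*} [Group B'] [Group N'] {i' : N' →* B'} {p' : B' →* Q} {V' : Type*}
  [AddCommGroup V'] [Module F V'] {θ' : Representation F N' V'}
  [Module.Finite F V] [Module.Finite F V']

open Classical in
/-- The correspondence `R ⊗ P ↦ R ⊗ P'` of isomorphism classes, where `P` and `P'` are projective
extensions with the same cocycle. Classes which do not have the form `R ⊗ P` are mapped to the
class of the zero representation. -/
noncomputable def corr (P : ProjExtension c i p θ) (P' : ProjExtension c i' p' θ')
    (χ : RepClass F B) : RepClass F B' :=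
  if h : ∃ (k : ℕ) (R : TwistedRep c (Fin k → F)), repClass (P.mulRep R) = χ then
    repClass (P'.mulRep h.choose_spec.choose)
  else repClass (1 : Representation F B' (Fin 0 → F))

variable [IsAlgClosed F] (P : ProjExtension c i p θ) (P' : ProjExtension c i' p' θ')

theorem corr_repClass_mulRep [Module.Finite F W] (hθ : θ.IsIrreducible) (R : TwistedRep c W) :
    P.corr P' (repClass (P.mulRep R)) = repClass (P'.mulRep R) := by
  have h : ∃ (k : ℕ) (S : TwistedRep c (Fin k → F)),
      repClass (P.mulRep S) = repClass (P.mulRep R) := by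
    refine ⟨_, R.transport (Module.finBasis F W).equivFun, Eq.symm ?_⟩
    exact P.repClass_mulRep_eq (Module.finBasis F W).equivFun fun q w => by
      simp [TwistedRep.transport]
  rw [corr, dif_pos h]
  obtain ⟨e, he⟩ := P.exists_equiv_of_repClass_eq hθ h.choose_spec.choose_spec
  exact P'.repClass_mulRep_eq e he

/-- The correspondence `R ⊗ P ↦ R ⊗ P'` is compatible with composition series. -/
theorem compFactors_corr (hθ : θ.IsIrreducible) (hθ' : θ'.IsIrreducible) {χ : RepClass F B}
    {m : Multiset (RepClass F B)} (h : χ.CompFactors m) :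
    ∀ {W : Type u} [AddCommGroup W] [Module F W] [Module.Finite F W] (R : TwistedRep c W),
      repClass (P.mulRep R) = χ →
      RepClass.CompFactors (repClass (P'.mulRep R)) (m.map (P.corr P')) := by
  have := hθ.nontrivial
  induction h with
  | zero ρ =>
    intro W _ _ _ R hR
    obtain ⟨e⟩ := (repClass_eq_iff _ _).1 hR
    have h1 : Subsingleton (W ⊗[F] V) := e.toLinearEquiv.toEquiv.subsingleton
    have h2 : Subsingleton W := by
      by_contra hW
      rw [not_subsingleton_iff_nontrivial] at hW
      exact not_subsingleton (W ⊗[F] V) h1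
    exact RepClass.CompFactors.zero_of_subsingleton _
  | @cons n ρ U hU hirr m hm ih =>
    intro W _ _ _ R hR
    obtain ⟨e⟩ := (repClass_eq_iff _ _).1 hR
    obtain ⟨S, hS, hK⟩ := P.exists_sub_of_stable hθ R (U.comap e.toLinearMap) (fun g x hx => by
      have h1 := hU g hx
      rw [Submodule.mem_comap] at h1 ⊢
      have h2 : e.toLinearMap (P.mulRep R g x) = ρ g (e.toLinearMap x) := e.map_apply g x
      rwa [h2])
    have hsub : ∀ q (w : S), S.subtype ((R.sub S hS).toFun q w) = R.toFun q (S.subtype w) :=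
      fun _ _ => rfl
    have hquot : ∀ q w, S.mkQ (R.toFun q w) = (R.quot S hS).toFun q (S.mkQ w) := fun _ _ => rfl
    have hinj : Function.Injective (S.subtype.rTensor V) :=
      Module.Flat.rTensor_preserves_injective_linearMap _ S.injective_subtype
    have hinj' : Function.Injective (S.subtype.rTensor V') :=
      Module.Flat.rTensor_preserves_injective_linearMap _ S.injective_subtype
    have hsurj : Function.Surjective e.toLinearMap := e.toLinearEquiv.surjective
    -- the isomorphism `e` identifies the given subrepresentation with `S ⊗ V`
    have h1 : repClass (ρ.subrepresentation U hU) = repClass (P.mulRep (R.sub S hS)) := by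
      refine repClass_subrepresentation_eq U hU
        (e.toIntertwiningMap.comp (P.mulMap S.subtype hsub))
        (e.toLinearEquiv.injective.comp hinj) ?_
      change LinearMap.range (e.toLinearMap ∘ₗ S.subtype.rTensor V) = U
      rw [LinearMap.range_comp, ← hK, Submodule.map_comap_eq_of_surjective hsurj]
    have h2 : repClass (ρ.quotient U hU) = repClass (P.mulRep (R.quot S hS)) := by
      refine repClass_quotient_eq U hU
        ((P.mulMap S.mkQ hquot).comp e.symm.toIntertwiningMap)
        ((LinearMap.rTensor_surjective _ S.mkQ_surjective).comp e.symm.toLinearEquiv.surjective) ?_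
      change LinearMap.ker (S.mkQ.rTensor V ∘ₗ e.symm.toLinearMap) = U
      rw [LinearMap.ker_comp, rTensor_mkQ, ← hK, ← Submodule.comap_comp]
      have : e.toLinearMap ∘ₗ e.symm.toLinearMap = LinearMap.id :=
        LinearMap.ext e.apply_symm_apply
      rw [this, Submodule.comap_id]
    have h3 : (R.quot S hS).IsIrreducible := by
      rw [← P.isIrreducible_mulRep_iff hθ, ← repClass_mem_IBr_iff, ← h2, repClass_mem_IBr_iff]
      exact hirr
    rw [Multiset.map_cons, h2, P.corr_repClass_mulRep P' hθ]
    refine RepClass.CompFactors.of_exact (P'.mulMap S.subtype hsub) (P'.mulMap S.mkQ hquot)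
      hinj' (LinearMap.rTensor_surjective _ S.mkQ_surjective) (rTensor_mkQ _ _).symm
      ((P'.isIrreducible_mulRep_iff hθ' _).2 h3) (ih _ h1.symm)

theorem repClass_mulRep_mem_IBrOver [Module.Finite F W] (hθ : θ.IsIrreducible)
    {R : TwistedRep c W} (hR : R.IsIrreducible) :
    repClass (P.mulRep R) ∈ IBrOver i (repClass θ) := by
  refine ⟨(repClass_mem_IBr_iff _).2 ((P.isIrreducible_mulRep_iff hθ R).2 hR), ?_⟩
  rw [RepClass.repClass_res, repClass_isSubOf_iff]
  have := hR.1
  obtain ⟨w, hw⟩ := exists_ne (0 : W)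
  refine ⟨⟨TensorProduct.mk F W V w, fun n => LinearMap.ext fun v => ?_⟩, ?_⟩
  · exact (LinearMap.congr_fun (P.mulRep_incl R n) (w ⊗ₜ v)).symm
  · exact fun v v' h => sub_eq_zero.1 (eq_zero_of_tmul_eq_zero' (F := F) hw (by
      rw [TensorProduct.tmul_sub, sub_eq_zero]
      exact h))

/-- `IBr (B | θ)` consists of the classes of `R ⊗ P` for irreducible `R`. -/
theorem exists_of_mem_IBrOver (hθ : θ.IsIrreducible) {χ : RepClass F B}
    (h : χ ∈ IBrOver i (repClass θ)) :
    ∃ (k : ℕ) (R : TwistedRep c (Fin k → F)), R.IsIrreducible ∧ repClass (P.mulRep R) = χ := by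
  obtain ⟨⟨n, ρ, hρ, rfl⟩, hsub⟩ := h
  rw [RepClass.repClass_res, repClass_isSubOf_iff] at hsub
  obtain ⟨f, hf⟩ := hsub
  obtain ⟨k, R, hR⟩ := P.exists_repClass_mulRep_eq hθ hρ f hf
  refine ⟨k, R, ?_, hR⟩
  rw [← P.isIrreducible_mulRep_iff hθ, ← repClass_mem_IBr_iff, hR, repClass_mem_IBr_iff]
  exact hρ

/-- The correspondence `R ⊗ P ↦ R ⊗ P'` restricts to a bijection `IBr (B | θ) → IBr (B' | θ')`. -/
theorem corr_bijOn (hθ : θ.IsIrreducible) (hθ' : θ'.IsIrreducible) :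
    Set.BijOn (P.corr P') (IBrOver i (repClass θ)) (IBrOver i' (repClass θ')) := by
  refine ⟨fun χ hχ => ?_, fun χ hχ χ' hχ' h => ?_, fun χ hχ => ?_⟩
  · obtain ⟨k, R, hR, rfl⟩ := P.exists_of_mem_IBrOver hθ hχ
    rw [P.corr_repClass_mulRep P' hθ]
    exact P'.repClass_mulRep_mem_IBrOver hθ' hR
  · obtain ⟨k, R, hR, rfl⟩ := P.exists_of_mem_IBrOver hθ hχ
    obtain ⟨k', R', hR', rfl⟩ := P.exists_of_mem_IBrOver hθ hχ'
    rw [P.corr_repClass_mulRep P' hθ, P.corr_repClass_mulRep P' hθ] at h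
    obtain ⟨e, he⟩ := P'.exists_equiv_of_repClass_eq hθ' h
    exact P.repClass_mulRep_eq e he
  · obtain ⟨k, R, hR, rfl⟩ := P'.exists_of_mem_IBrOver hθ' hχ
    exact ⟨_, P.repClass_mulRep_mem_IBrOver hθ hR, P.corr_repClass_mulRep P' hθ R⟩

end Correspondence

end ProjExtension

end Twisted

/-! ### Isomorphisms of character triples from projective extensions -/

section TripleIso

variable {F : Type u} [Field F]

namespace RepClass

variable {G : Type*} [Group G] {V W : Type*} [AddCommGroup V] [Module F V] [Module.Finite F V]
  [AddCommGroup W] [Module F W] [Module.Finite F W]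

theorem repClass_tensor (ρ : Representation F G V) (σ : Representation F G W) :
    (repClass ρ).tensor (repClass σ) = repClass (ρ.tprod σ) := by
  refine (repClass_eq_of_equiv (Representation.Equiv.mk
    (TensorProduct.congr (Module.finBasis F V).equivFun (Module.finBasis F W).equivFun)
    fun g => TensorProduct.ext' fun v w => ?_)).symm
  simp [transportRep]

end RepClass

namespace ProjExtension

variable {B N Q : Type*} [Group B] [Group N] [Group Q] {c : Q → Q → Fˣ}
  {i : N →* B} {p : B →* Q} {V : Type*} [AddCommGroup V] [Module F V] [Module.Finite F V]
  {θ : Representation F N V} {W W' : Type*} [AddCommGroup W] [Module F W] [Module.Finite F W]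
  [AddCommGroup W'] [Module F W'] [Module.Finite F W']

theorem repClass_mulRep_tensor (P : ProjExtension c i p θ) (R : TwistedRep c W)
    (β : Representation F Q W') :
    (repClass (P.mulRep R)).tensor ((repClass β).res p) =
      repClass (P.mulRep (R.tensorRep β)) := by
  rw [RepClass.repClass_res, RepClass.repClass_tensor]
  refine (repClass_eq_of_equiv (Representation.Equiv.mk
    ((TensorProduct.assoc F W' W V).trans (TensorProduct.comm F W' (W ⊗[F] V)))
    fun g => TensorProduct.ext_threefold fun w' w v => ?_)).symm
  rfl

end ProjExtension

namespace CharTriple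

variable {G : Type v} [Group G] {Γ : Type w} [Group Γ]

/-- Restriction of a projective extension of `T.θ` to an intermediate group. -/
def projExtension (T : CharTriple F G) (c : G ⧸ T.N → G ⧸ T.N → Fˣ)
    {V : Type*} [AddCommGroup V] [Module F V] (θ : Representation F T.N V)
    (P : G → Module.End F V) (hP : ∀ g h : G, P g * P h = (c g h : F) • P (g * h))
    (hθ : ∀ n : T.N, P n = θ n) (J : Subgroup (G ⧸ T.N)) :
    ProjExtension (fun a b : J => c a b) (Subgroup.inclusion (T.le_pre J)) (T.proj J) θ where
  toFun g := P g
  map_mul g h := hP g h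
  map_incl n := hθ n
  mem_range_iff b := by
    rw [Subtype.ext_iff]
    change _ ↔ ((b : G) : G ⧸ T.N) = 1
    rw [QuotientGroup.eq_one_iff]
    constructor
    · rintro ⟨n, rfl⟩
      exact n.2
    · intro h
      exact ⟨⟨b, h⟩, rfl⟩
  surjective := by
    rintro ⟨q, hq⟩
    obtain ⟨g, rfl⟩ := QuotientGroup.mk_surjective q
    exact ⟨⟨g, hq⟩, rfl⟩

/-- Replacement of the quotient group in a projective extension by an isomorphic group. -/
def _root_.ProjExtension.ofEquiv {B N Q Q' : Type*} [Group B] [Group N] [Group Q] [Group Q']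
    {c : Q → Q → Fˣ} {i : N →* B} {p : B →* Q'} {V : Type*} [AddCommGroup V] [Module F V]
    {θ : Representation F N V} (e : Q' ≃* Q)
    (P : ProjExtension (fun a b => c (e a) (e b)) i p θ) :
    ProjExtension c i (e.toMonoidHom.comp p) θ where
  toFun := P.toFun
  map_mul := P.map_mul
  map_incl := P.map_incl
  mem_range_iff b := by
    rw [P.mem_range_iff]
    exact (map_eq_one_iff e e.injective).symm
  surjective := e.surjective.comp P.surjective

/-- Character triples `(G, N, θ)` and `(Γ, M, φ)` with `G / N ≃ Γ / M` are isomorphic if `θ` and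
`φ` extend to projective representations of `G` and `Γ` with the same cocycle on `G / N`. -/
theorem nonempty_iso_of_projective [IsAlgClosed F] (T : CharTriple F G) (T' : CharTriple F Γ)
    (τ : G ⧸ T.N ≃* Γ ⧸ T'.N) (c : G ⧸ T.N → G ⧸ T.N → Fˣ)
    {V V' : Type*} [AddCommGroup V] [Module F V] [Module.Finite F V]
    [AddCommGroup V'] [Module F V'] [Module.Finite F V']
    (θ : Representation F T.N V) (θ' : Representation F T'.N V')
    (P : G → Module.End F V) (P' : Γ → Module.End F V')
    (hcθ : repClass θ = T.θ) (hcθ' : repClass θ' = T'.θ)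
    (hP : ∀ g h : G, P g * P h = (c g h : F) • P (g * h))
    (hP' : ∀ g h : Γ, P' g * P' h = (c (τ.symm g) (τ.symm h) : F) • P' (g * h))
    (hθ : ∀ n : T.N, P n = θ n) (hθ' : ∀ n : T'.N, P' n = θ' n) :
    Nonempty (CharTriple.Iso T T') := by
  have hirr : θ.IsIrreducible := by
    rw [← repClass_mem_IBr_iff, hcθ]
    exact T.irreducible
  have hirr' : θ'.IsIrreducible := by
    rw [← repClass_mem_IBr_iff, hcθ']
    exact T'.irreducible
  let E := T.projExtension c θ P hP hθ
  let E₁ := T'.projExtension (fun a b => c (τ.symm a) (τ.symm b)) θ' P' hP' hθ'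
  let E' : ∀ J : Subgroup (G ⧸ T.N), ProjExtension (fun a b : J => c a b) _
      ((τ.subgroupMap J).symm.toMonoidHom.comp (T'.proj (J.map τ.toMonoidHom))) θ' := fun J =>
    ProjExtension.ofEquiv (τ.subgroupMap J).symm
      (c := fun a b : J => c a b) (E₁ (J.map τ.toMonoidHom))
  have hover : ∀ J, T.irrOver J = IBrOver (Subgroup.inclusion (T.le_pre J)) (repClass θ) := by
    intro J
    rw [hcθ]
    rfl
  refine ⟨{
    τ := τ
    σ := fun J => (E J).corr (E' J)
    bijOn := fun J => ?_
    restrict := fun J₁ J₂ h χ hχ m hm => ?_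
    mul := fun J χ hχ β hβ m hm => ?_ }⟩
  · have h := (E J).corr_bijOn (E' J) hirr hirr'
    rw [hcθ, hcθ'] at h
    exact h
  · rw [hover] at hχ
    obtain ⟨k, R, hR, rfl⟩ := (E J₂).exists_of_mem_IBrOver hirr hχ
    rw [(E J₂).corr_repClass_mulRep (E' J₂) hirr]
    exact (E J₁).compFactors_corr (E' J₁) hirr hirr' hm (R.comp (Subgroup.inclusion h)) rfl
  · rw [hover] at hχ
    obtain ⟨k, R, hR, rfl⟩ := (E J).exists_of_mem_IBrOver hirr hχ
    obtain ⟨l, S, hS, rfl⟩ := hβ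
    rw [(E J).repClass_mulRep_tensor] at hm
    have h := (E J).compFactors_corr (E' J) hirr hirr' hm _ rfl
    rw [← (E' J).repClass_mulRep_tensor] at h
    rw [(E J).corr_repClass_mulRep (E' J) hirr]
    exact h

end CharTriple

end TripleIso

/-! ### Clifford's correspondence -/

section Clifford

variable {F : Type*} [Field F]

namespace Representation

/-- The restriction of a representation along a homomorphism. -/
abbrev resHom {G H V : Type*} [Group G] [Group H] [AddCommGroup V] [Module F V]
    (ρ : Representation F G V) (f : H →* G) : Representation F H V :=
  ρ.comp f

variable {G : Type*} [Group G] {V U U' : Type*} [AddCommGroup V] [Module F V]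
  [AddCommGroup U] [Module F U] [AddCommGroup U'] [Module F U']

/-- The subspace spanned by the images of the intertwining maps from `θ` to `ρ`. -/
def isoPart (θ : Representation F G V) (ρ : Representation F G U) : Submodule F U :=
  ⨆ f : θ.IntertwiningMap ρ, LinearMap.range f.toLinearMap

theorem apply_mem_isoPart {θ : Representation F G V} {ρ : Representation F G U}
    (f : θ.IntertwiningMap ρ) (v : V) : f v ∈ isoPart θ ρ :=
  Submodule.mem_iSup_of_mem (p := fun f : θ.IntertwiningMap ρ => LinearMap.range f.toLinearMap)
    f ⟨v, rfl⟩

theorem isoPart_induction {θ : Representation F G V} {ρ : Representation F G U}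
    {K : Submodule F U} (h : ∀ (f : θ.IntertwiningMap ρ) v, f v ∈ K) : isoPart θ ρ ≤ K := by
  refine iSup_le fun f => ?_
  rintro _ ⟨v, rfl⟩
  exact h f v

theorem map_mem_isoPart {θ : Representation F G V} {ρ : Representation F G U}
    {ρ' : Representation F G U'} (g : ρ.IntertwiningMap ρ') {x : U} (hx : x ∈ isoPart θ ρ) :
    g x ∈ isoPart θ ρ' := by
  have h : isoPart θ ρ ≤ (isoPart θ ρ').comap g.toLinearMap :=
    isoPart_induction fun f v => apply_mem_isoPart (g.comp f) v
  exact h hx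

/-- The subspace spanned by the translates of a subspace. -/
def orbitSpan (ρ : Representation F G U) (S : Submodule F U) : Submodule F U :=
  ⨆ g, S.map (ρ g)

theorem apply_mem_orbitSpan (ρ : Representation F G U) {S : Submodule F U} (g : G) {x : U}
    (hx : x ∈ S) : ρ g x ∈ orbitSpan ρ S :=
  Submodule.mem_iSup_of_mem (p := fun g => S.map (ρ g)) g ⟨x, hx, rfl⟩

theorem le_orbitSpan (ρ : Representation F G U) (S : Submodule F U) : S ≤ orbitSpan ρ S := by
  intro x hx
  have := apply_mem_orbitSpan ρ 1 hx
  rwa [map_one] at this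

theorem orbitSpan_le {ρ : Representation F G U} {S K : Submodule F U}
    (h : ∀ g, ∀ x ∈ S, ρ g x ∈ K) : orbitSpan ρ S ≤ K := by
  refine iSup_le fun g => ?_
  rintro _ ⟨x, hx, rfl⟩
  exact h g x hx

theorem orbitSpan_stable (ρ : Representation F G U) (S : Submodule F U) (g : G) {x : U}
    (hx : x ∈ orbitSpan ρ S) : ρ g x ∈ orbitSpan ρ S := by
  have h : orbitSpan ρ S ≤ (orbitSpan ρ S).comap (ρ g) := orbitSpan_le fun k y hy => by
    rw [Submodule.mem_comap, ← Module.End.mul_apply, ← map_mul]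
    exact apply_mem_orbitSpan ρ _ hy
  exact h hx

end Representation

open Representation

theorem repClass_mem_IBrOver_iff {G H V U : Type*} [Group G] [Group H] [AddCommGroup V] [Module F V]
    [Module.Finite F V] [AddCommGroup U] [Module F U] [Module.Finite F U] (i : H →* G)
    (θ : Representation F H V) (ρ : Representation F G U) :
    repClass ρ ∈ IBrOver i (repClass θ) ↔ ρ.IsIrreducible ∧
      ∃ f : θ.IntertwiningMap (ρ.resHom i), Function.Injective f := by
  rw [← repClass_mem_IBr_iff, ← repClass_isSubOf_iff, ← RepClass.repClass_res]
  rfl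

theorem ne_zero_of_injective {G V U : Type*} [Group G] [AddCommGroup V] [Module F V]
    [AddCommGroup U] [Module F U] {θ : Representation F G V} {ρ : Representation F G U}
    (hθ : θ.IsIrreducible) (f : θ.IntertwiningMap ρ) (hf : Function.Injective f) : f ≠ 0 := by
  rintro rfl
  have := hθ.nontrivial
  obtain ⟨v, hv⟩ := exists_ne (0 : V)
  exact hv (hf rfl)

/-- The situation of Clifford's correspondence: `N` is a normal subgroup of `B` (by means of the
embedding `i`) and `T` is the stabilizer in `B` of the representation `θ` of `N`. -/
structure StabilizerSetup {B N T : Type*} [Group B] [Group N] [Group T] (i : N →* B) (j : N →* T)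
    (t : T →* B) {V : Type*} [AddCommGroup V] [Module F V] (θ : Representation F N V) where
  injective : Function.Injective t
  comp_apply : ∀ n, t (j n) = i n
  conj : B → N ≃* N
  conj_apply : ∀ b n, i (conj b n) = b * i n * b⁻¹
  mem_range_iff : ∀ b, b ∈ t.range ↔ Nonempty ((θ.resHom (conj b).toMonoidHom).Equiv θ)

namespace StabilizerSetup

variable {B N T : Type*} [Group B] [Group N] [Group T] {i : N →* B} {j : N →* T}
  {t : T →* B} {V : Type*} [AddCommGroup V] [Module F V] {θ : Representation F N V}
  (C : StabilizerSetup i j t θ)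
  {U U' E : Type*} [AddCommGroup U] [Module F U] [AddCommGroup U'] [Module F U']
  [AddCommGroup E] [Module F E]

/-- `e` acts as the identity on the conjugates of `θ` which are isomorphic to `θ`, and as zero on
the other ones. -/
def Separates (e : F[N]) : Prop :=
  (∀ b ∈ t.range, (θ.resHom (C.conj b).toMonoidHom).asAlgebraHom e = 1) ∧
    ∀ b ∉ t.range, (θ.resHom (C.conj b).toMonoidHom).asAlgebraHom e = 0

theorem exists_separates [Finite B] [Module.Finite F V] (hθ : θ.IsIrreducible) :
    ∃ e : F[N], C.Separates e := by
  refine exists_asAlgebraHom_separating (fun b => θ.resHom (C.conj b).toMonoidHom)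
    (fun b => hθ.comp_surjective (C.conj b).surjective) (t.range : Set B) fun b hb b' hb' => ?_
  refine ⟨fun f => hb' ((C.mem_range_iff b').2 ?_)⟩
  obtain ⟨g⟩ := (C.mem_range_iff b).1 hb
  exact ⟨f.symm.trans g⟩

/-- The translate by `b` of an `N`-map defined on `θ` is defined on a conjugate of `θ`. -/
def translate (ρ : Representation F B U) (f : θ.IntertwiningMap (ρ.resHom i)) (b : B) :
    (θ.resHom (C.conj b⁻¹).toMonoidHom).IntertwiningMap (ρ.resHom i) where
  toLinearMap := ρ b ∘ₗ f.toLinearMap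
  isIntertwining' n := LinearMap.ext fun v => by
    have h1 := LinearMap.congr_fun (f.isIntertwining' (C.conj b⁻¹ n)) v
    change f.toLinearMap (θ (C.conj b⁻¹ n) v) = ρ (i (C.conj b⁻¹ n)) (f.toLinearMap v) at h1
    change ρ b (f.toLinearMap (θ (C.conj b⁻¹ n) v)) = ρ (i n) (ρ b (f.toLinearMap v))
    rw [h1, ← Module.End.mul_apply, ← Module.End.mul_apply, ← map_mul, ← map_mul, C.conj_apply,
      show b * (b⁻¹ * i n * b⁻¹⁻¹) = i n * b by group]

theorem separates_apply_of_mem {e : F[N]} (he : C.Separates e) (ρ : Representation F B U) {b : B}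
    (hb : b ∈ t.range) {x : U} (hx : x ∈ isoPart θ (ρ.resHom i)) :
    (ρ.resHom i).asAlgebraHom e (ρ b x) = ρ b x := by
  have h : isoPart θ (ρ.resHom i) ≤
      LinearMap.eqLocus ((ρ.resHom i).asAlgebraHom e ∘ₗ ρ b) (ρ b) :=
    isoPart_induction fun f v => by
      have h1 := (C.translate ρ f b).map_asAlgebraHom e v
      rw [he.1 _ (inv_mem hb)] at h1
      exact h1.symm
  exact h hx

theorem separates_apply_of_notMem {e : F[N]} (he : C.Separates e) (ρ : Representation F B U)
    {b : B} (hb : b ∉ t.range) {x : U} (hx : x ∈ isoPart θ (ρ.resHom i)) :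
    (ρ.resHom i).asAlgebraHom e (ρ b x) = 0 := by
  have h : isoPart θ (ρ.resHom i) ≤
      LinearMap.ker ((ρ.resHom i).asAlgebraHom e ∘ₗ ρ b) :=
    isoPart_induction fun f v => by
      have h1 := (C.translate ρ f b).map_asAlgebraHom e v
      rw [he.2 _ (fun h => hb (by simpa using inv_mem h))] at h1
      exact h1.symm.trans (map_zero (C.translate ρ f b).toLinearMap)
  exact h hx

theorem separates_apply {e : F[N]} (he : C.Separates e) (ρ : Representation F B U) {x : U}
    (hx : x ∈ isoPart θ (ρ.resHom i)) : (ρ.resHom i).asAlgebraHom e x = x := by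
  have := C.separates_apply_of_mem he ρ (one_mem _) hx
  rwa [map_one] at this

/-- The `θ`-isotypic part is stable under the stabilizer of `θ`. -/
theorem isoPart_stable (C : StabilizerSetup i j t θ) (σ : Representation F T E) (s : T) {x : E}
    (hx : x ∈ isoPart θ (σ.resHom j)) : σ s x ∈ isoPart θ (σ.resHom j) := by
  obtain ⟨φ⟩ := (C.mem_range_iff (t s)⁻¹).1 (inv_mem ⟨s, rfl⟩)
  have hj : ∀ n, j n * s = s * j (C.conj (t s)⁻¹ n) := fun n => C.injective (by
    rw [map_mul, map_mul, C.comp_apply, C.comp_apply, C.conj_apply]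
    group)
  have h : isoPart θ (σ.resHom j) ≤ (isoPart θ (σ.resHom j)).comap (σ s) :=
    isoPart_induction fun f v => by
      let f' : θ.IntertwiningMap (σ.resHom j) :=
        { toLinearMap := σ s ∘ₗ f.toLinearMap ∘ₗ φ.symm.toLinearMap
          isIntertwining' := fun n => LinearMap.ext fun v => by
            have h1 : φ.symm.toLinearMap (θ n v) =
              θ (C.conj (t s)⁻¹ n) (φ.symm.toLinearMap v) := φ.symm.map_apply n v
            have h2 : ∀ m w, f.toLinearMap (θ m w) = σ (j m) (f.toLinearMap w) := fun m w =>
              LinearMap.congr_fun (f.isIntertwining' m) w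
            change σ s (f.toLinearMap (φ.symm.toLinearMap (θ n v))) =
              σ (j n) (σ s (f.toLinearMap (φ.symm.toLinearMap v)))
            rw [h1, h2, ← Module.End.mul_apply, ← Module.End.mul_apply, ← map_mul, ← map_mul, hj] }
      have h3 := apply_mem_isoPart f' (φ v)
      have h4 : f' (φ v) = σ s (f v) :=
        congrArg (fun y => σ s (f.toLinearMap y)) (φ.symm_apply_apply v)
      rwa [h4] at h3
  exact h hx

theorem resHom_resHom (C : StabilizerSetup i j t θ) (ρ : Representation F B U) :
    (ρ.resHom t).resHom j = ρ.resHom i := by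
  ext n : 1
  exact congrArg ρ (C.comp_apply n)

theorem isoPart_stable' (C : StabilizerSetup i j t θ) (ρ : Representation F B U) (s : T) {x : U}
    (hx : x ∈ isoPart θ (ρ.resHom i)) : ρ (t s) x ∈ isoPart θ (ρ.resHom i) := by
  rw [← C.resHom_resHom] at hx ⊢
  exact C.isoPart_stable (ρ.resHom t) s hx

/-- The representation of the stabilizer on the `θ`-isotypic part of a representation of `B`. -/
def isoRep (ρ : Representation F B U) : Representation F T (isoPart θ (ρ.resHom i)) :=
  (ρ.resHom t).subrepresentation _ fun s _ hx => C.isoPart_stable' ρ s hx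

theorem isoPart_eq_top (C : StabilizerSetup i j t θ) {σ : Representation F T E}
    (hσ : σ.IsIrreducible) (f : θ.IntertwiningMap (σ.resHom j)) (hf : f ≠ 0) :
    isoPart θ (σ.resHom j) = ⊤ := by
  rcases ((isIrreducible_iff_submodule σ).1 hσ).2 (isoPart θ (σ.resHom j))
    (fun s x hx => C.isoPart_stable σ s hx) with h | h
  · refine absurd (IntertwiningMap.ext (LinearMap.ext fun v => ?_)) hf
    have := apply_mem_isoPart f v
    rwa [h, Submodule.mem_bot] at this
  · exact h

/-- `e` projects the submodule generated by a `T`-stable subspace `S` of the `θ`-isotypic part back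
to `S`. -/
theorem separates_orbitSpan {e : F[N]} (he : C.Separates e) (ρ : Representation F B U)
    {S : Submodule F U} (hS : S ≤ isoPart θ (ρ.resHom i))
    (hst : ∀ s, ∀ x ∈ S, ρ (t s) x ∈ S) {x : U} (hx : x ∈ orbitSpan ρ S) :
    (ρ.resHom i).asAlgebraHom e x ∈ S := by
  have h : orbitSpan ρ S ≤ S.comap ((ρ.resHom i).asAlgebraHom e) :=
    orbitSpan_le fun b x hx => by
      rw [Submodule.mem_comap]
      by_cases hb : b ∈ t.range
      · rw [C.separates_apply_of_mem he ρ hb (hS hx)]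
        obtain ⟨s, rfl⟩ := hb
        exact hst s x hx
      · rw [C.separates_apply_of_notMem he ρ hb (hS hx)]
        exact S.zero_mem
  exact h hx

/-- The `θ`-isotypic part of an irreducible `ρ` is irreducible: a nonzero submodule `S` generates
`ρ` under `B`, and is recovered from the submodule which it generates by means of `e`. -/
theorem isIrreducible_isoRep {e : F[N]} (he : C.Separates e) {ρ : Representation F B U}
    (hρ : ρ.IsIrreducible) (f : θ.IntertwiningMap (ρ.resHom i)) (hf : f ≠ 0) :
    (C.isoRep ρ).IsIrreducible := by
  rw [isIrreducible_iff_submodule]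
  constructor
  · by_contra hn
    rw [not_nontrivial_iff_subsingleton] at hn
    refine hf (IntertwiningMap.ext (LinearMap.ext fun v => ?_))
    exact congrArg Subtype.val
      (Subsingleton.elim (⟨_, apply_mem_isoPart f v⟩ : isoPart θ (ρ.resHom i)) 0)
  · intro S hS
    let S₀ := S.map (isoPart θ (ρ.resHom i)).subtype
    have hS₀ : S₀ ≤ isoPart θ (ρ.resHom i) := Submodule.map_subtype_le _ _
    have hst : ∀ s, ∀ x ∈ S₀, ρ (t s) x ∈ S₀ := by
      rintro s _ ⟨x, hx, rfl⟩
      exact ⟨_, hS s x hx, rfl⟩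
    rcases ((isIrreducible_iff_submodule ρ).1 hρ).2 (orbitSpan ρ S₀)
      (fun b x hx => orbitSpan_stable ρ S₀ b hx) with h | h
    · left
      have h1 := le_orbitSpan ρ S₀
      rw [h, le_bot_iff] at h1
      rw [Submodule.eq_bot_iff]
      intro x hx
      have h2 : (x : U) ∈ S₀ := ⟨x, hx, rfl⟩
      rw [h1, Submodule.mem_bot] at h2
      exact Subtype.ext h2
    · right
      rw [eq_top_iff]
      intro x _
      have h1 := C.separates_orbitSpan he ρ hS₀ hst (x := x) (h ▸ Submodule.mem_top)
      rw [C.separates_apply he ρ x.2] at h1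
      obtain ⟨y, hy, hyx⟩ := h1
      rwa [← Subtype.ext hyx]

/-- An irreducible representation of the stabilizer over `θ` which embeds into `ρ` is the
`θ`-isotypic part of `ρ`. -/
theorem nonempty_equiv_isoRep {e : F[N]} (he : C.Separates e) {ρ : Representation F B U}
    (hρ : ρ.IsIrreducible) {σ : Representation F T E} (hσ : σ.IsIrreducible)
    (f : θ.IntertwiningMap (σ.resHom j)) (hf : f ≠ 0)
    (g : σ.IntertwiningMap (ρ.resHom t)) (hg : Function.Injective g) :
    Nonempty (σ.Equiv (C.isoRep ρ)) := by
  have htop := C.isoPart_eq_top hσ f hf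
  let g' : (σ.resHom j).IntertwiningMap (ρ.resHom i) :=
    { toLinearMap := g.toLinearMap
      isIntertwining' := fun n => by
        rw [← C.resHom_resHom]
        exact g.isIntertwining' (j n) }
  have hmem : ∀ x, g x ∈ isoPart θ (ρ.resHom i) := fun x =>
    map_mem_isoPart g' (htop ▸ Submodule.mem_top)
  let g'' : σ.IntertwiningMap (C.isoRep ρ) :=
    { toLinearMap := g.toLinearMap.codRestrict _ hmem
      isIntertwining' := fun s => LinearMap.ext fun x => Subtype.ext
        (LinearMap.congr_fun (g.isIntertwining' s) x) }
  have hg'' : Function.Injective g'' := fun x y hxy => hg (congrArg Subtype.val hxy)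
  have hgf : g'.comp f ≠ 0 := fun h => hf (IntertwiningMap.ext (LinearMap.ext fun v =>
    hg ((congrArg (fun k : θ.IntertwiningMap (ρ.resHom i) => k v) h).trans
      (map_zero g.toLinearMap).symm)))
  have hirr := C.isIrreducible_isoRep he hρ (g'.comp f) hgf
  rcases IsIrreducible.bijective_or_eq_zero g'' with h | h
  · exact ⟨g''.ofBijective h⟩
  · exfalso
    have := hσ.nontrivial
    obtain ⟨x, hx⟩ := exists_ne (0 : E)
    exact hx (hg'' (by rw [h]; rfl))

/-- An irreducible representation of `B` over `θ` is determined by its `θ`-isotypic part. -/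
theorem nonempty_equiv_of_isoRep_equiv {e : F[N]} (he : C.Separates e)
    {ρ : Representation F B U} {ρ' : Representation F B U'}
    (hρ : ρ.IsIrreducible) (hρ' : ρ'.IsIrreducible)
    (f : θ.IntertwiningMap (ρ.resHom i)) (hf : f ≠ 0)
    (φ : (C.isoRep ρ).Equiv (C.isoRep ρ')) : Nonempty (ρ.Equiv ρ') := by
  -- the submodule of the direct sum generated by the graph of `φ` is the graph of an isomorphism
  have hirr := C.isIrreducible_isoRep he hρ f hf
  have hn := hirr.nontrivial
  obtain ⟨x₀, hx₀⟩ := exists_ne (0 : isoPart θ (ρ.resHom i))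
  have hφx₀ : φ x₀ ≠ 0 := fun h => hx₀ (φ.toLinearEquiv.map_eq_zero_iff.1 h)
  let π := ρ.prod ρ'
  let γ : (isoPart θ (ρ.resHom i)) →ₗ[F] U × U' :=
    (Submodule.subtype _).prod (Submodule.subtype _ ∘ₗ φ.toLinearMap)
  have hγ : ∀ x, γ x = ((x : U), (φ x : U')) := fun _ => rfl
  let S := LinearMap.range γ
  have hinl : ∀ x ∈ isoPart θ (ρ.resHom i), (x, (0 : U')) ∈ isoPart θ (π.resHom i) :=
    fun x hx => map_mem_isoPart (ρ' := π.resHom i)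
      ⟨LinearMap.inl F U U', fun n => LinearMap.ext fun y => by simp [π]⟩ hx
  have hinr : ∀ x ∈ isoPart θ (ρ'.resHom i), ((0 : U), x) ∈ isoPart θ (π.resHom i) :=
    fun x hx => map_mem_isoPart (ρ' := π.resHom i)
      ⟨LinearMap.inr F U U', fun n => LinearMap.ext fun y => by simp [π]⟩ hx
  have hS : S ≤ isoPart θ (π.resHom i) := by
    rintro _ ⟨x, rfl⟩
    have := Submodule.add_mem _ (hinl x x.2) (hinr _ (φ x).2)
    simpa [hγ] using this
  have hst : ∀ s, ∀ x ∈ S, π (t s) x ∈ S := by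
    rintro s _ ⟨x, rfl⟩
    refine ⟨C.isoRep ρ s x, ?_⟩
    rw [hγ, φ.map_apply]
    rfl
  let D := orbitSpan π S
  have hD : ∀ b, ∀ x ∈ D, π b x ∈ D := fun b x hx => orbitSpan_stable π S b hx
  -- `D` meets the isotypic part in the graph of `φ` only
  have hinter : ∀ y ∈ isoPart θ (π.resHom i), y ∈ D → y ∈ S := fun y hy hyD => by
    have := C.separates_orbitSpan he π hS hst hyD
    rwa [C.separates_apply he π hy] at this
  let δ := π.subrepresentation D hD
  let p₁ : δ.IntertwiningMap ρ := ⟨LinearMap.fst F U U' ∘ₗ D.subtype, fun b => rfl⟩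
  let p₂ : δ.IntertwiningMap ρ' := ⟨LinearMap.snd F U U' ∘ₗ D.subtype, fun b => rfl⟩
  have hx₀D : γ x₀ ∈ D := le_orbitSpan π S ⟨x₀, rfl⟩
  have hsurj₁ : Function.Surjective p₁ := by
    refine (IsIrreducible.surjective_or_eq_zero p₁).resolve_right fun h => hx₀ (Subtype.ext ?_)
    exact congrArg (fun k : δ.IntertwiningMap ρ => k ⟨_, hx₀D⟩) h
  have hsurj₂ : Function.Surjective p₂ := by
    refine (IsIrreducible.surjective_or_eq_zero p₂).resolve_right fun h => hφx₀ (Subtype.ext ?_)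
    exact congrArg (fun k : δ.IntertwiningMap ρ' => k ⟨_, hx₀D⟩) h
  -- the kernel of `p₁` corresponds to a submodule of `ρ'`, and conversely for `p₂`
  have hinj₁ : Function.Injective p₁ := by
    rcases ((isIrreducible_iff_submodule ρ').1 hρ').2 (D.comap (LinearMap.inr F U U'))
      (fun b w hw => by
        have := hD b _ hw
        simpa [π] using this) with h | h
    · refine (injective_iff_map_eq_zero p₁.toLinearMap).2 fun x hx => Subtype.ext ?_
      have h1 : (x : U × U').1 = 0 := hx
      have h2 : (x : U × U').2 ∈ D.comap (LinearMap.inr F U U') := by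
        have h3 : ((0 : U), (x : U × U').2) = x := Prod.ext h1.symm rfl
        rw [Submodule.mem_comap, LinearMap.inr_apply, h3]
        exact x.2
      rw [h, Submodule.mem_bot] at h2
      exact Prod.ext h1 h2
    · exfalso
      have h1 : ((φ x₀ : isoPart θ (ρ'.resHom i)) : U') ∈ D.comap (LinearMap.inr F U U') :=
        h ▸ Submodule.mem_top
      obtain ⟨y, hy⟩ := hinter _ (hinr _ (φ x₀).2) h1
      rw [hγ, Prod.mk.injEq] at hy
      have hy0 : y = 0 := Subtype.ext hy.1
      rw [hy0] at hy
      exact hφx₀ (Subtype.ext (hy.2.symm.trans (congrArg Subtype.val (map_zero φ.toLinearEquiv))))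
  have hinj₂ : Function.Injective p₂ := by
    rcases ((isIrreducible_iff_submodule ρ).1 hρ).2 (D.comap (LinearMap.inl F U U'))
      (fun b w hw => by
        have := hD b _ hw
        simpa [π] using this) with h | h
    · refine (injective_iff_map_eq_zero p₂.toLinearMap).2 fun x hx => Subtype.ext ?_
      have h1 : (x : U × U').2 = 0 := hx
      have h2 : (x : U × U').1 ∈ D.comap (LinearMap.inl F U U') := by
        have h3 : ((x : U × U').1, (0 : U')) = x := Prod.ext rfl h1.symm
        rw [Submodule.mem_comap, LinearMap.inl_apply, h3]
        exact x.2
      rw [h, Submodule.mem_bot] at h2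
      exact Prod.ext h2 h1
    · exfalso
      have h1 : (x₀ : U) ∈ D.comap (LinearMap.inl F U U') := h ▸ Submodule.mem_top
      obtain ⟨y, hy⟩ := hinter _ (hinl _ x₀.2) h1
      rw [hγ, Prod.mk.injEq] at hy
      have hyx : y = x₀ := Subtype.ext hy.1
      rw [hyx] at hy
      exact hφx₀ (Subtype.ext hy.2)
  exact ⟨(p₁.ofBijective ⟨hinj₁, hsurj₁⟩).symm.trans (p₂.ofBijective ⟨hinj₂, hsurj₂⟩)⟩

section Coinduction

variable (σ : Representation F T E)

theorem coind_apply_apply (b b' : B) (f : coindV t σ) :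
    ((coind t σ b f : coindV t σ) : B → E) b' = (f : B → E) (b' * b) := rfl

open Classical in
/-- The function on `B` which is supported on the stabilizer and takes the value `x` at `1`. -/
noncomputable def extendFun (t : T →* B) (σ : Representation F T E) (x : E) (b : B) : E :=
  if h : ∃ s, t s = b then σ h.choose x else 0

theorem extendFun_apply (C : StabilizerSetup i j t θ) (x : E) (s : T) :
    extendFun t σ x (t s) = σ s x := by
  have h : ∃ s', t s' = t s := ⟨s, rfl⟩
  rw [extendFun, dif_pos h, C.injective h.choose_spec]

theorem extendFun_of_notMem (t : T →* B) (x : E) {b : B} (hb : b ∉ t.range) :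
    extendFun t σ x b = 0 :=
  dif_neg hb

/-- The embedding of a representation of the stabilizer into the coinduced representation. -/
noncomputable def coindIncl : σ.IntertwiningMap ((coind t σ).resHom t) where
  toLinearMap :=
    { toFun := fun x => ⟨extendFun t σ x, fun s b => by
        by_cases hb : b ∈ t.range
        · obtain ⟨s', rfl⟩ := hb
          rw [← map_mul, extendFun_apply σ C, extendFun_apply σ C, map_mul]
          rfl
        · have hb' : t s * b ∉ t.range := fun h =>
            hb ((Subgroup.mul_mem_cancel_left _ (MonoidHom.mem_range.2 ⟨s, rfl⟩)).1 h)
          rw [extendFun_of_notMem σ t x hb, extendFun_of_notMem σ t x hb', map_zero]⟩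
      map_add' := fun x y => Subtype.ext (funext fun b => by
        change extendFun t σ (x + y) b = extendFun t σ x b + extendFun t σ y b
        unfold extendFun
        split_ifs <;> simp)
      map_smul' := fun a x => Subtype.ext (funext fun b => by
        change extendFun t σ (a • x) b = a • extendFun t σ x b
        unfold extendFun
        split_ifs <;> simp) }
  isIntertwining' s := LinearMap.ext fun x => Subtype.ext (funext fun b => by
    change extendFun t σ (σ s x) b = extendFun t σ x (b * t s)
    by_cases hb : b ∈ t.range
    · obtain ⟨s', rfl⟩ := hb
      rw [← map_mul, extendFun_apply σ C, extendFun_apply σ C, map_mul]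
      rfl
    · have hb' : b * t s ∉ t.range := fun h =>
        hb ((Subgroup.mul_mem_cancel_right _ (MonoidHom.mem_range.2 ⟨s, rfl⟩)).1 h)
      rw [extendFun_of_notMem σ t _ hb, extendFun_of_notMem σ t x hb'])

theorem coindIncl_apply (x : E) (b : B) :
    ((C.coindIncl σ x : coindV t σ) : B → E) b = extendFun t σ x b := rfl

/-- Evaluation at `b` is an `N`-map from the coinduced representation to a conjugate of `σ`. -/
def evalAt (b : B) : ((coind t σ).resHom i).IntertwiningMap
    ((σ.resHom j).resHom (C.conj b).toMonoidHom) where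
  toLinearMap := LinearMap.proj b ∘ₗ (coindV t σ).subtype
  isIntertwining' n := LinearMap.ext fun f => by
    change (f : B → E) (b * i n) = σ (j (C.conj b n)) ((f : B → E) b)
    rw [← f.2 (j (C.conj b n)) b, C.comp_apply, C.conj_apply, inv_mul_cancel_right]

/-- If `σ` is `θ`-isotypic, then `e` acts on the coinduced representation as the projection to the
functions supported on the stabilizer. -/
theorem separates_coind {e : F[N]} (he : C.Separates e) (htop : isoPart θ (σ.resHom j) = ⊤)
    (f : coindV t σ) :
    ((coind t σ).resHom i).asAlgebraHom e f = C.coindIncl σ ((f : B → E) 1) := by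
  refine Subtype.ext (funext fun b => ?_)
  have h1 : ((((coind t σ).resHom i).asAlgebraHom e f : coindV t σ) : B → E) b =
      ((σ.resHom j).resHom (C.conj b).toMonoidHom).asAlgebraHom e ((f : B → E) b) :=
    (C.evalAt σ b).map_asAlgebraHom e f
  have h2 : ∀ x, ∀ k : θ.IntertwiningMap (σ.resHom j),
      ((σ.resHom j).resHom (C.conj b).toMonoidHom).asAlgebraHom e (k x) =
      k ((θ.resHom (C.conj b).toMonoidHom).asAlgebraHom e x) := fun x k =>
    (IntertwiningMap.map_asAlgebraHom (ρ := θ.resHom (C.conj b).toMonoidHom)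
      (σ := (σ.resHom j).resHom (C.conj b).toMonoidHom)
      ⟨k.toLinearMap, fun n => k.isIntertwining' _⟩ e x).symm
  have hmem : ((f : B → E) b) ∈ isoPart θ (σ.resHom j) := htop ▸ Submodule.mem_top
  rw [h1, coindIncl_apply]
  by_cases hb : b ∈ t.range
  · have h3 : isoPart θ (σ.resHom j) ≤ LinearMap.eqLocus
        (((σ.resHom j).resHom (C.conj b).toMonoidHom).asAlgebraHom e) LinearMap.id :=
      isoPart_induction fun k x => by
        rw [LinearMap.mem_eqLocus, h2, he.1 b hb]
        rfl
    refine Eq.trans (h3 hmem) ?_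
    obtain ⟨s, rfl⟩ := hb
    rw [extendFun_apply σ C, ← f.2 s 1, mul_one]
    rfl
  · have h3 : isoPart θ (σ.resHom j) ≤ LinearMap.ker
        (((σ.resHom j).resHom (C.conj b).toMonoidHom).asAlgebraHom e) :=
      isoPart_induction fun k x => by
        rw [LinearMap.mem_ker, h2, he.2 b hb]
        exact map_zero k.toLinearMap
    rw [extendFun_of_notMem σ t _ hb]
    exact h3 hmem

theorem coindIncl_injective : Function.Injective (C.coindIncl σ) := fun x y h => by
  have h1 := congrFun (congrArg Subtype.val h) 1
  rw [coindIncl_apply, coindIncl_apply, ← map_one t, extendFun_apply σ C, extendFun_apply σ C,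
    map_one] at h1
  exact h1

/-- Suppose that `e` projects a representation `τ` of `B` onto the image of an irreducible
representation `σ` of the stabilizer, and that the translates of the kernel of this projection
have trivial intersection. Then the submodule generated by the image of `σ` is irreducible. -/
theorem exists_irreducible_generated {M : Type*} [AddCommGroup M] [Module F M]
    [Module.Finite F M] {e : F[N]} {σ : Representation F T E} (hσ : σ.IsIrreducible)
    (τ : Representation F B M) (κ : σ.IntertwiningMap (τ.resHom t)) (hκ : Function.Injective κ)
    (ev : M → E) (he : ∀ x, (τ.resHom i).asAlgebraHom e x = κ (ev x))
    (hev : ∀ x, x ≠ 0 → ∃ b, ev (τ b x) ≠ 0) :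
    ∃ (n : ℕ) (ρ : Representation F B (Fin n → F)), ρ.IsIrreducible ∧
      ∃ g : σ.IntertwiningMap (ρ.resHom t), Function.Injective g := by
  have := hσ.nontrivial
  obtain ⟨x₀, hx₀⟩ := exists_ne (0 : E)
  let D := orbitSpan τ (LinearMap.range κ.toLinearMap)
  have hD : ∀ b, ∀ x ∈ D, τ b x ∈ D := fun b x hx => orbitSpan_stable _ _ b hx
  have hκD : ∀ x, κ x ∈ D := fun x => le_orbitSpan _ _ ⟨x, rfl⟩
  let δ := τ.subrepresentation D hD
  have hirr : δ.IsIrreducible := by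
    rw [isIrreducible_iff_submodule]
    refine ⟨⟨⟨κ x₀, hκD x₀⟩, 0, fun h => hx₀ (hκ ?_)⟩, fun K hK => ?_⟩
    · exact (congrArg Subtype.val h).trans (map_zero κ.toLinearMap).symm
    rw [or_iff_not_imp_left]
    intro hne
    let K₀ := K.map D.subtype
    have hK₀ : ∀ b, ∀ x ∈ K₀, τ b x ∈ K₀ := by
      rintro b _ ⟨x, hx, rfl⟩
      exact ⟨δ b x, hK b x hx, rfl⟩
    obtain ⟨k, hk, hk0⟩ := (Submodule.ne_bot_iff _).1 hne
    obtain ⟨b, hb⟩ := hev k fun h => hk0 (Subtype.ext h)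
    -- translating `k` and projecting with `e` yields a nonzero element of the image of `σ`
    have h1 : κ (ev (τ b k)) ∈ K₀ := by
      rw [← he]
      exact asAlgebraHom_mem_of_forall_mem (τ.resHom i) K₀ (fun n x hx => hK₀ (i n) x hx) _
        (hK₀ b k ⟨k, hk, rfl⟩) e
    rcases ((isIrreducible_iff_submodule σ).1 hσ).2 (K₀.comap κ.toLinearMap)
      (fun s x hx => by
        have h2 : κ.toLinearMap (σ s x) = τ (t s) (κ.toLinearMap x) :=
          LinearMap.congr_fun (κ.isIntertwining' s) x
        rw [Submodule.mem_comap] at hx ⊢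
        rw [h2]
        exact hK₀ _ _ hx) with h | h
    · refine absurd ?_ hb
      rw [← Submodule.mem_bot F, ← h]
      exact h1
    · have h2 : D ≤ K₀ := by
        refine orbitSpan_le ?_
        rintro b _ ⟨x, rfl⟩
        refine hK₀ _ _ ?_
        have : x ∈ K₀.comap κ.toLinearMap := h ▸ Submodule.mem_top
        exact this
      rw [eq_top_iff]
      intro x _
      obtain ⟨y, hy, hyx⟩ := h2 x.2
      rwa [← Subtype.ext hyx]
  have e' := transportRepEquiv δ (Module.finBasis F D).equivFun
  refine ⟨_, _, hirr.of_equiv e', ?_⟩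
  let g : σ.IntertwiningMap (δ.resHom t) :=
    { toLinearMap := κ.toLinearMap.codRestrict D hκD
      isIntertwining' := fun s => LinearMap.ext fun x => Subtype.ext
        (LinearMap.congr_fun (κ.isIntertwining' s) x) }
  refine ⟨⟨e'.toLinearMap ∘ₗ g.toLinearMap, fun s => LinearMap.ext fun x => ?_⟩, ?_⟩
  · have h1 : g.toLinearMap (σ s x) = δ (t s) (g.toLinearMap x) :=
      LinearMap.congr_fun (g.isIntertwining' s) x
    change e'.toLinearMap (g.toLinearMap (σ s x)) = _
    rw [h1]
    exact e'.map_apply _ _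
  · refine e'.toLinearEquiv.injective.comp fun x y h => hκ ?_
    exact congrArg Subtype.val h

/-- An irreducible representation of the stabilizer over `θ` embeds into the restriction of an
irreducible representation of `B`, namely the submodule which it generates in the coinduced
representation. -/
theorem exists_irreducible_extension [Finite B] [Module.Finite F E] {e : F[N]}
    (he : C.Separates e) (hσ : σ.IsIrreducible) (f : θ.IntertwiningMap (σ.resHom j))
    (hf : f ≠ 0) :
    ∃ (n : ℕ) (ρ : Representation F B (Fin n → F)), ρ.IsIrreducible ∧
      ∃ g : σ.IntertwiningMap (ρ.resHom t), Function.Injective g := by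
  have htop := C.isoPart_eq_top hσ f hf
  exact exists_irreducible_generated (M := coindV t σ) hσ (coind t σ) (C.coindIncl σ)
    (C.coindIncl_injective σ) (fun x => (x : B → E) 1) (fun x => C.separates_coind σ he htop x)
    fun x hx => by
      by_contra! h
      refine hx (Subtype.ext (funext fun b => ?_))
      have h1 := h b
      rw [coind_apply_apply, one_mul] at h1
      exact h1

end Coinduction

theorem repClass_isoRep_mem_IBrOver [Module.Finite F V] [Module.Finite F U] {e : F[N]}
    (he : C.Separates e) (hθ : θ.IsIrreducible) {ρ : Representation F B U}
    (hρ : repClass ρ ∈ IBrOver i (repClass θ)) :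
    repClass (C.isoRep ρ) ∈ IBrOver j (repClass θ) := by
  obtain ⟨hirr, f, hf⟩ := (repClass_mem_IBrOver_iff _ _ _).1 hρ
  refine (repClass_mem_IBrOver_iff _ _ _).2
    ⟨C.isIrreducible_isoRep he hirr f (ne_zero_of_injective hθ f hf),
    ⟨f.toLinearMap.codRestrict _ (apply_mem_isoPart f), fun n => LinearMap.ext fun v =>
      Subtype.ext ?_⟩, fun x y hxy => hf (congrArg Subtype.val hxy)⟩
  have h1 : f.toLinearMap (θ n v) = ρ (i n) (f.toLinearMap v) :=
    LinearMap.congr_fun (f.isIntertwining' n) v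
  change f.toLinearMap (θ n v) = ρ (t (j n)) (f.toLinearMap v)
  rw [C.comp_apply, h1]

theorem exists_repClass_isoRep_eq [Finite B] [Module.Finite F V] [Module.Finite F E] {e : F[N]}
    (he : C.Separates e) (hθ : θ.IsIrreducible) {σ : Representation F T E}
    (hσ : repClass σ ∈ IBrOver j (repClass θ)) :
    ∃ χ ∈ IBrOver i (repClass θ), ∀ (n : ℕ) (ρ : Representation F B (Fin n → F)),
      repClass ρ = χ → repClass (C.isoRep ρ) = repClass σ := by
  obtain ⟨hirr, k, hk⟩ := (repClass_mem_IBrOver_iff _ _ _).1 hσ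
  have hk0 := ne_zero_of_injective hθ k hk
  obtain ⟨l, π, hπ, g, hg⟩ := C.exists_irreducible_extension σ he hirr k hk0
  refine ⟨repClass π, (repClass_mem_IBrOver_iff _ _ _).2 ⟨hπ,
    ⟨g.toLinearMap ∘ₗ k.toLinearMap, fun n => LinearMap.ext fun v => ?_⟩, hg.comp hk⟩,
    fun n ρ hρ => ?_⟩
  · have h1 : k.toLinearMap (θ n v) = σ (j n) (k.toLinearMap v) :=
      LinearMap.congr_fun (k.isIntertwining' n) v
    have h2 : g.toLinearMap (σ (j n) (k.toLinearMap v)) =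
        π (t (j n)) (g.toLinearMap (k.toLinearMap v)) :=
      LinearMap.congr_fun (g.isIntertwining' (j n)) _
    change g.toLinearMap (k.toLinearMap (θ n v)) = π (i n) (g.toLinearMap (k.toLinearMap v))
    rw [h1, h2, C.comp_apply]
  · obtain ⟨φ⟩ := (repClass_eq_iff _ _).1 hρ.symm
    let g' : σ.IntertwiningMap (ρ.resHom t) :=
      ⟨φ.toLinearMap ∘ₗ g.toLinearMap, fun s => LinearMap.ext fun x => by
        have h1 : g.toLinearMap (σ s x) = π (t s) (g.toLinearMap x) :=
          LinearMap.congr_fun (g.isIntertwining' s) x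
        change φ.toLinearMap (g.toLinearMap (σ s x)) = ρ (t s) (φ.toLinearMap (g.toLinearMap x))
        rw [h1]
        exact φ.map_apply _ _⟩
    obtain ⟨ξ⟩ := C.nonempty_equiv_isoRep he (hπ.of_equiv φ) hirr k hk0 g'
      (φ.toLinearEquiv.injective.comp hg)
    exact (repClass_eq_of_equiv ξ).symm

/-- **Clifford's correspondence**: the irreducible representations of `B` over `θ` are in bijection
with the irreducible representations of the stabilizer of `θ` over `θ`. -/
theorem encard_IBrOver_eq [Finite B] [Module.Finite F V] (C : StabilizerSetup i j t θ)
    (hθ : θ.IsIrreducible) :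
    (IBrOver i (repClass θ)).encard = (IBrOver j (repClass θ)).encard := by
  obtain ⟨e, he⟩ := C.exists_separates hθ
  have hex : ∀ χ : RepClass F B, ∃ (n : ℕ) (ρ : Representation F B (Fin n → F)),
    repClass ρ = χ := repClass_surj
  choose n ρ hρ using hex
  have hbij : Set.BijOn (fun χ => repClass (C.isoRep (ρ χ))) (IBrOver i (repClass θ))
      (IBrOver j (repClass θ)) := by
    refine ⟨fun χ hχ => ?_, fun χ hχ χ' hχ' h => ?_, fun χ hχ => ?_⟩
    · rw [← hρ χ] at hχ
      exact C.repClass_isoRep_mem_IBrOver he hθ hχ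
    · rw [← hρ χ] at hχ ⊢
      rw [← hρ χ'] at hχ' ⊢
      obtain ⟨hirr, f, hf⟩ := (repClass_mem_IBrOver_iff _ _ _).1 hχ
      obtain ⟨φ⟩ := (repClass_eq_iff _ _).1 h
      obtain ⟨g⟩ := C.nonempty_equiv_of_isoRep_equiv he hirr
        ((repClass_mem_IBrOver_iff _ _ _).1 hχ').1 f (ne_zero_of_injective hθ f hf) φ
      exact repClass_eq_of_equiv g
    · obtain ⟨m, σ, rfl⟩ := repClass_surj χ
      obtain ⟨χ', hχ', h⟩ := C.exists_repClass_isoRep_eq he hθ hχ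
      exact ⟨χ', hχ', h _ _ (hρ χ')⟩
  rw [← hbij.image_eq, hbij.injOn.encard_image]

end StabilizerSetup

end Clifford

/-! ### Normalization of cocycles -/

section Cocycle

variable {F : Type u} [Field F]

/-- Two representations which are intertwined by `u` up to scalars are intertwined by `u` on the
commutator subgroup: the scalars are multiplicative, hence trivial on commutators. -/
theorem mul_eq_mul_of_mem_commutator {K V : Type*} [Group K] [AddCommGroup V] [Module F V]
    (ρ σ : Representation F K V) (u : Module.End F V) (hu : u ≠ 0)
    (h : ∀ x, ∃ c : F, u * ρ x = c • (σ x * u)) {x : K} (hx : x ∈ commutator K) :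
    u * ρ x = σ x * u := by
  choose c hc using h
  let S : Subgroup K :=
    { carrier := {x | u * ρ x = σ x * u}
      one_mem' := by simp
      mul_mem' := fun {a b} ha hb => by
        simp only [Set.mem_ofPred_eq] at ha hb ⊢
        rw [map_mul, map_mul, ← mul_assoc, ha, mul_assoc, hb, mul_assoc]
      inv_mem' := fun {a} ha => by
        simp only [Set.mem_ofPred_eq] at ha ⊢
        calc u * ρ a⁻¹ = σ a⁻¹ * (σ a * u) * ρ a⁻¹ := by
              rw [← mul_assoc, ← map_mul, inv_mul_cancel, map_one, one_mul]
          _ = σ a⁻¹ * u := by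
              rw [← ha, mul_assoc, mul_assoc, ← map_mul, mul_inv_cancel, map_one, mul_one] }
  have hmul : ∀ a b, u * ρ (a * b) = (c a * c b) • (σ (a * b) * u) := fun a b => by
    rw [map_mul, ← mul_assoc, hc, smul_mul_assoc, mul_assoc, hc, mul_smul_comm, smul_smul,
      ← mul_assoc, ← map_mul]
  have hinv : ∀ a, c a * c a⁻¹ = 1 := fun a => by
    have := hmul a a⁻¹
    rw [mul_inv_cancel, map_one, map_one, one_mul, mul_one] at this
    refine smul_left_injective F hu ?_
    simp only [one_smul]
    exact this.symm
  have hS : commutator K ≤ S := by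
    rw [commutator_def, Subgroup.commutator_le]
    intro a _ b _
    change u * ρ (a * b * a⁻¹ * b⁻¹) = σ (a * b * a⁻¹ * b⁻¹) * u
    have h1 : u * ρ (a * b * (a⁻¹ * b⁻¹)) =
        ((c a * c a⁻¹) * (c b * c b⁻¹)) • (σ (a * b * (a⁻¹ * b⁻¹)) * u) := by
      rw [map_mul, ← mul_assoc, hmul, smul_mul_assoc, mul_assoc, hmul, mul_smul_comm, smul_smul,
        ← mul_assoc (σ (a * b)), ← map_mul]
      congr 1
      ring
    rw [hinv, hinv, one_mul, one_smul] at h1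
    rw [mul_assoc (a * b)]
    exact h1
  exact hS hx

/-- Let `A` and `H` have projective representations `P` and `Q` whose cocycles agree along
`h : H → A`. Assume that on the normal subgroup `N` of `A` and on a subgroup `M` of `H` which is
mapped to `N`, the maps `P` and `Q` are, up to the same scalars, the linear representations `θ` and
`θ'`. Then `P` and `Q` can be rescaled so as to extend `θ` and `θ'`, with a common cocycle which is
inflated from `A / N`. -/
theorem exists_normalized_projective {A H : Type*} [Group A] [Group H] (h : H →* A)
    (N : Subgroup A) [N.Normal] (M : Subgroup H) (hM : ∀ x ∈ M, h x ∈ N)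
    {V V' : Type*} [AddCommGroup V] [Module F V] [Nontrivial V] [AddCommGroup V'] [Module F V']
    (P : A → Module.End F V) (Q : H → Module.End F V') (a : A → A → Fˣ)
    (hP1 : P 1 = 1) (hP : ∀ g k, P g * P k = (a g k : F) • P (g * k))
    (hQ : ∀ x y, Q x * Q y = (a (h x) (h y) : F) • Q (x * y))
    (θ : Representation F N V) (θ' : Representation F M V') (μ : N → Fˣ)
    (hPθ : ∀ n : N, P n = (μ n : F) • θ n)
    (hQθ : ∀ m : M, Q m = (μ ⟨h m, hM m m.2⟩ : F) • θ' m)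
    (hcomm : ∀ (g : A) (n n' : N), (n' : A) = g * n * g⁻¹ → P g * θ n = θ n' * P g) :
    ∃ (P' : A → Module.End F V) (Q' : H → Module.End F V') (c : A ⧸ N → A ⧸ N → Fˣ),
      (∀ g k : A, P' g * P' k = (c g k : F) • P' (g * k)) ∧
      (∀ x y : H, Q' x * Q' y = (c (h x) (h y) : F) • Q' (x * y)) ∧
      (∀ n : N, P' n = θ n) ∧ (∀ m : M, Q' m = θ' m) := by
  classical
  have hP0 : ∀ g, P g ≠ 0 := fun g hg => by
    have h1 := hP g g⁻¹
    rw [mul_inv_cancel, hP1, hg, zero_mul] at h1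
    exact (smul_ne_zero (a g g⁻¹).ne_zero one_ne_zero) h1.symm
  have ha1 : ∀ g, a g 1 = 1 := fun g => by
    have h1 := hP g 1
    rw [hP1, mul_one, mul_one] at h1
    refine Units.ext (smul_left_injective F (hP0 g) ?_)
    simp only [Units.val_one, one_smul]
    exact h1.symm
  -- a transversal of `N` in `A` with `1` as a representative
  obtain ⟨T, hT, hT1⟩ : ∃ T : A ⧸ N → A, (∀ q, (T q : A ⧸ N) = q) ∧ T 1 = 1 := by
    refine ⟨Function.update (fun q => q.out) 1 1, fun q => ?_, Function.update_self _ _ _⟩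
    by_cases hq : q = 1
    · rw [hq, Function.update_self]
      rfl
    · rw [Function.update_of_ne hq]
      exact Quotient.out_eq' q
  have hx : ∀ g : A, g * (T g)⁻¹ ∈ N := fun g => by
    rw [← QuotientGroup.eq_one_iff, QuotientGroup.mk_mul, QuotientGroup.mk_inv, hT, mul_inv_cancel]
  let ξ : A → N := fun g => ⟨g * (T g)⁻¹, hx g⟩
  -- the scalar which makes `P' (n * T q) = θ n * P (T q)` hold for `n ∈ N` and `q ∈ A / N`
  let l : A → Fˣ := fun g => (μ (ξ g))⁻¹ * a (ξ g) (T g)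
  let P' : A → Module.End F V := fun g => (l g : F) • P g
  let Q' : H → Module.End F V' := fun x => (l (h x) : F) • Q x
  let a' : A → A → Fˣ := fun g k => l g * l k * (l (g * k))⁻¹ * a g k
  have hP'0 : ∀ g, P' g ≠ 0 := fun g => smul_ne_zero (l g).ne_zero (hP0 g)
  have hP'eq : ∀ g, P' g = θ (ξ g) * P (T g) := fun g => by
    have h1 : (μ (ξ g) : F) • (θ (ξ g) * P (T g)) = (a (ξ g) (T g) : F) • P g := by
      rw [← smul_mul_assoc, ← hPθ, hP]
      simp [ξ]
    have h2 := congrArg (fun f => (((μ (ξ g))⁻¹ : Fˣ) : F) • f) h1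
    simp only [smul_smul, Units.inv_mul, one_smul] at h2
    rw [h2, ← Units.val_mul]
  have hcancel : ∀ r s t : Fˣ, r * s = r * t⁻¹ * s * t := fun r s t => by
    rw [mul_right_comm _ s t, inv_mul_cancel_right]
  have hP' : ∀ g k, P' g * P' k = (a' g k : F) • P' (g * k) := fun g k => by
    simp only [P', a']
    rw [smul_mul_smul_comm, hP, smul_smul, smul_smul, ← Units.val_mul, ← Units.val_mul,
      ← Units.val_mul]
    congr 2
    exact hcancel _ _ _
  have hQ' : ∀ x y, Q' x * Q' y = (a' (h x) (h y) : F) • Q' (x * y) := fun x y => by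
    simp only [Q', a']
    rw [smul_mul_smul_comm, hQ, smul_smul, smul_smul, ← Units.val_mul, ← Units.val_mul,
      ← Units.val_mul, map_mul]
    congr 2
    exact hcancel _ _ _
  have hl : ∀ n : N, l n = (μ n)⁻¹ := fun n => by
    have h1 : T (n : A) = 1 := by rw [(QuotientGroup.eq_one_iff _).2 n.2, hT1]
    have h2 : ξ n = n := Subtype.ext (by simp only [ξ]; rw [h1, inv_one, mul_one])
    simp only [l]
    rw [h1, h2, ha1, mul_one]
  have hPN : ∀ n : N, P' n = θ n := fun n => by
    simp only [P']
    rw [hl, hPθ, smul_smul, Units.inv_mul, one_smul]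
  have hQM : ∀ m : M, Q' m = θ' m := fun m => by
    simp only [Q']
    have h1 : l (h m) = (μ ⟨h m, hM m m.2⟩)⁻¹ := hl ⟨h m, hM m m.2⟩
    rw [h1, hQθ, smul_smul, Units.inv_mul, one_smul]
  have hleft : ∀ (n : N) (g : A), P' (n * g) = θ n * P' g := fun n g => by
    have h1 : ((n * g : A) : A ⧸ N) = g := by
      rw [QuotientGroup.mk_mul, (QuotientGroup.eq_one_iff _).2 n.2, one_mul]
    have h2 : ξ (n * g) = n * ξ g := Subtype.ext (by
      simp only [ξ, Subgroup.coe_mul]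
      rw [h1, mul_assoc])
    rw [hP'eq, hP'eq, h1, h2, map_mul, mul_assoc]
  have hright : ∀ (n n' : N) (g : A), (n' : A) = g * n * g⁻¹ →
      P' (n' * g) = P' g * θ n := fun n n' g hn => by
    rw [hleft]
    simp only [P']
    rw [mul_smul_comm, ← hcomm g n n' hn, smul_mul_assoc]
  -- the new cocycle is constant on cosets in each argument
  have ha'1 : ∀ (n : N) (g k : A), a' (n * g) k = a' g k := fun n g k => by
    refine Units.ext (smul_left_injective F (hP'0 (n * g * k)) ?_)
    change _ • _ = _ • _
    rw [← hP', hleft, mul_assoc, hP', mul_smul_comm, ← hleft, mul_assoc]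
  have ha'2 : ∀ (n : N) (g k : A), a' g (n * k) = a' g k := fun n g k => by
    let n' : N := ⟨g * n * g⁻¹, ‹N.Normal›.conj_mem n n.2 g⟩
    have h1 : g * (n * k) = n' * g * k := by simp [n', mul_assoc]
    rw [← ha'1 n' g k]
    refine Units.ext (smul_left_injective F (hP'0 (n' * g * k)) ?_)
    change _ • _ = _ • _
    rw [← hP', hright n n' g rfl, ← h1, ← hP', hleft, mul_assoc]
  have hcoset : ∀ g : A, ∃ n : N, ((g : A ⧸ N).out : A) = n * g := fun g => by
    have h1 : (((g : A ⧸ N).out : A) : A ⧸ N) = g := Quotient.out_eq' _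
    refine ⟨⟨(g : A ⧸ N).out * g⁻¹, ?_⟩, by simp⟩
    rw [← QuotientGroup.eq_one_iff, QuotientGroup.mk_mul, h1, QuotientGroup.mk_inv, mul_inv_cancel]
  have hc : ∀ g k : A, a' (g : A ⧸ N).out (k : A ⧸ N).out = a' g k := fun g k => by
    obtain ⟨n, hn⟩ := hcoset g
    obtain ⟨n', hn'⟩ := hcoset k
    rw [hn, hn', ha'1, ha'2]
  refine ⟨P', Q', fun q r => a' q.out r.out, fun g k => ?_, fun x y => ?_, hPN, hQM⟩
  · simp only [hc, hP']
  · simp only [hc, hQ']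

end Cocycle

open Representation

/-! ### Character triples of stabilizers -/

section InertiaTriple

variable {F : Type u} [Field F]

theorem isSubOf_res_equiv {G H : Type*} [Group G] [Group H] (e : H ≃* G) {θ χ : RepClass F G} :
    (θ.res e.toMonoidHom).IsSubOf (χ.res e.toMonoidHom) ↔ θ.IsSubOf χ := by
  obtain ⟨n, ρ, rfl⟩ := repClass_surj θ
  obtain ⟨m, σ, rfl⟩ := repClass_surj χ
  rw [RepClass.repClass_res, RepClass.repClass_res, repClass_isSubOf_iff, repClass_isSubOf_iff]
  constructor
  · rintro ⟨f, hf⟩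
    refine ⟨⟨f.toLinearMap, fun g => ?_⟩, hf⟩
    obtain ⟨h, rfl⟩ := e.surjective g
    exact f.isIntertwining' h
  · rintro ⟨f, hf⟩
    exact ⟨⟨f.toLinearMap, fun h => f.isIntertwining' (e h)⟩, hf⟩

/-- Clifford's correspondence for the character triple `(N_G(K)_χ, K, χ)` and an intermediate group
`N_G(K)_χ ≤ B ≤ N_G(K)` (given by means of an embedding into `G`). -/
theorem encard_IBrOver_eq_irrOver_top {G : Type*} [Group G] [Finite G] (K : Subgroup G)
    (χ : RepClass F K) (hχ : χ ∈ IBr F K) {B : Type*} [Group B] (d : B →* G)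
    (hd : Function.Injective d) (hin : inertia K χ ≤ d.range)
    (hnorm : d.range ≤ Subgroup.normalizer (K : Set G)) (κ : K →* B) (hκ : ∀ k, d (κ k) = k) :
    (IBrOver κ χ).encard = ((inertiaTriple K χ hχ).irrOver ⊤).encard := by
  have := Finite.of_injective d hd
  let D := inertiaTriple K χ hχ
  let e : (K.subgroupOf (inertia K χ)) ≃* K := Subgroup.subgroupOfEquivOfLe (le_inertia K χ)
  let j : K →* D.pre ⊤ := (Subgroup.inclusion (D.le_pre ⊤)).comp e.symm.toMonoidHom
  let t₀ : D.pre ⊤ →* G := (inertia K χ).subtype.comp (D.pre ⊤).subtype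
  have ht₀ : ∀ x, t₀ x ∈ d.range := fun x => hin x.1.2
  let t : D.pre ⊤ →* B :=
    (MonoidHom.ofInjective hd).symm.toMonoidHom.comp (t₀.codRestrict d.range ht₀)
  have ht : ∀ x, d (t x) = t₀ x := fun x =>
    MonoidHom.apply_ofInjective_symm hd ⟨t₀ x, ht₀ x⟩
  have hj : ∀ k, t₀ (j k) = k := fun k => rfl
  obtain ⟨n, θ, hθ, rfl⟩ := id hχ
  let conj : B → K ≃* K := fun b => K.normalizerMonoidHom ⟨d b, hnorm ⟨b, rfl⟩⟩
  have hconj : ∀ b k, ((conj b k : K) : G) = d b * k * (d b)⁻¹ := fun b k => rfl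
  have hC : StabilizerSetup κ j t θ :=
    { injective := fun x y h => by
        have h1 : t₀ x = t₀ y := by rw [← ht, ← ht, h]
        exact Subtype.ext (Subtype.ext h1)
      comp_apply := fun k => hd (by rw [ht, hj, hκ])
      conj := conj
      conj_apply := fun b k => hd (by
        rw [hκ, hconj, map_mul, map_mul, map_inv, hκ])
      mem_range_iff := fun b => by
        rw [← repClass_eq_iff, ← RepClass.repClass_res]
        constructor
        · rintro ⟨x, rfl⟩
          obtain ⟨f, hf, hf'⟩ := x.1.2
          have h1 : conj (t x) = f := MulEquiv.ext fun k => Subtype.ext (by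
            rw [hconj, hf, ht]
            rfl)
          rw [h1]
          exact hf'
        · intro h
          have h1 : d b ∈ inertia K (repClass θ) := ⟨conj b, fun k => rfl, h⟩
          exact ⟨⟨⟨d b, h1⟩, Subgroup.mem_top _⟩, hd (ht _)⟩ }
  rw [hC.encard_IBrOver_eq hθ]
  congr 1
  ext ξ
  refine and_congr_right fun _ => ?_
  rw [← isSubOf_res_equiv e, RepClass.res_res]
  rfl

end InertiaTriple

/-! ### Restrictions to normal and to central subgroups -/

section Auxiliary

variable {F : Type u} [Field F]

/-- If `L` affords the restriction of `χ` along `f`, then there is a representation affording `χ`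
which restricts to `L`. -/
theorem exists_repClass_eq_restrict {G K : Type*} [Group G] [Group K] (χ : RepClass F G)
    (f : K →* G) {n : ℕ} (L : Representation F K (Fin n → F)) (hL : repClass L = χ.res f) :
    ∃ R : Representation F G (Fin n → F), repClass R = χ ∧ ∀ k, R (f k) = L k := by
  obtain ⟨m, ρ, rfl⟩ := repClass_surj χ
  rw [RepClass.repClass_res] at hL
  obtain ⟨φ⟩ := (repClass_eq_iff _ _).1 hL.symm
  exact ⟨transportRep ρ φ.toLinearEquiv,
    repClass_eq_of_equiv (transportRepEquiv ρ φ.toLinearEquiv).symm, fun k =>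
    Equiv.conj_apply_self k φ⟩

/-- A central subgroup acts on an irreducible representation by scalars, and by the same scalars on
every representation lying below. -/
theorem exists_central_scalar [IsAlgClosed F] {G K V W : Type*} [Group G] [Group K] [AddCommGroup V]
    [Module F V] [AddCommGroup W] [Module F W] [Module.Finite F V] {ρ : Representation F G V}
    (hρ : ρ.IsIrreducible) (f : K →* G) (hf : ∀ k, f k ∈ Subgroup.center G)
    {σ : Representation F K W} (g : σ.IntertwiningMap (ρ.resHom f)) (hg : Function.Injective g)
    (k : K) : ∃ c : F, ρ (f k) = c • LinearMap.id ∧ σ k = c • LinearMap.id := by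
  obtain ⟨c, hc⟩ := hρ.exists_eq_smul (ρ (f k)) fun x => by
    change ρ (f k) * ρ x = ρ x * ρ (f k)
    rw [← map_mul, ← map_mul, Subgroup.mem_center_iff.1 (hf k)]
  refine ⟨c, hc, LinearMap.ext fun w => hg ?_⟩
  have h1 : g.toLinearMap (σ k w) = ρ (f k) (g.toLinearMap w) :=
    LinearMap.congr_fun (g.isIntertwining' k) w
  change g.toLinearMap (σ k w) = g.toLinearMap (c • w)
  rw [h1, hc, map_smul]
  rfl

end Auxiliary

/-! ### The action on the commutator subgroup -/

section GroupTheory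

variable {F : Type u} [Field F] {G : Type v} [Group G]

theorem conj_mem_of_mem_inertia {K : Subgroup G} {χ : RepClass F K} {g : G}
    (hg : g ∈ inertia K χ) {k : G} (hk : k ∈ K) : g * k * g⁻¹ ∈ K := by
  obtain ⟨f, hf, -⟩ := hg
  have h1 := hf ⟨k, hk⟩
  rw [MulAut.conj_apply] at h1
  rw [← h1]
  exact (f _).2

theorem inertia_le_normalizer (K : Subgroup G) (χ : RepClass F K) :
    inertia K χ ≤ Subgroup.normalizer (K : Set G) := by
  intro g hg
  rw [Subgroup.mem_normalizer_iff]
  refine fun k => ⟨fun hk => conj_mem_of_mem_inertia hg hk, fun hk => ?_⟩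
  have := conj_mem_of_mem_inertia (inv_mem hg) hk
  simpa [mul_assoc] using this

/-- The stabilizer of `χ` acts on a normal subgroup `K` by automorphisms which fix the restriction
of `χ` to `K`. -/
theorem conjNormal_mem_autStab {X K : Subgroup G} [K.Normal] (hKX : K ≤ X)
    {χ : RepClass F X} {g : G} (hg : g ∈ inertia X χ) :
    MulAut.conjNormal g ∈ autStab (χ.res (Subgroup.inclusion hKX)) := by
  obtain ⟨f, hf, hf'⟩ := hg
  change (χ.res _).res _ = χ.res _
  conv_rhs => rw [← hf']
  rw [RepClass.res_res, RepClass.res_res]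
  congr 1
  ext k
  change g * k * g⁻¹ = f _
  rw [hf]
  rfl

/-- The stabilizer of `ψ` acts on a normal subgroup `K` by automorphisms which fix the restriction
of `ψ` to `Y ∩ K`. -/
theorem conjNormal_mem_autPairStab {Y K : Subgroup G} [K.Normal] {ψ : RepClass F Y} {g : G}
    (hg : g ∈ inertia Y ψ) :
    MulAut.conjNormal g ∈ autPairStab (Y.subgroupOf K) (ψ.res (K.subtype.subgroupComap Y)) := by
  obtain ⟨f, hf, hf'⟩ := id hg
  have hconj : ∀ x ∈ inertia Y ψ, ∀ y : Y.subgroupOf K,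
      (MulAut.conjNormal x (y : K) : K) ∈ Y.subgroupOf K := fun x hx y => by
    rw [Subgroup.mem_subgroupOf, MulAut.conjNormal_apply]
    exact conj_mem_of_mem_inertia hx y.2
  let f₀ : (Y.subgroupOf K) ≃* (Y.subgroupOf K) :=
    { toFun := fun y => ⟨MulAut.conjNormal g (y : K), hconj g hg y⟩
      invFun := fun y => ⟨MulAut.conjNormal g⁻¹ (y : K), hconj g⁻¹ (inv_mem hg) y⟩
      left_inv := fun y => by
        apply Subtype.ext
        change (MulAut.conjNormal g⁻¹ : MulAut K) ((MulAut.conjNormal g : MulAut K) (y : K)) = y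
        rw [← MulAut.mul_apply, ← map_mul, inv_mul_cancel, map_one]
        rfl
      right_inv := fun y => by
        apply Subtype.ext
        change (MulAut.conjNormal g : MulAut K) ((MulAut.conjNormal g⁻¹ : MulAut K) (y : K)) = y
        rw [← MulAut.mul_apply, ← map_mul, mul_inv_cancel, map_one]
        rfl
      map_mul' := fun y y' => Subtype.ext (map_mul _ _ _) }
  refine ⟨f₀, fun y => rfl, ?_⟩
  let q : Y.subgroupOf K →* Y := K.subtype.subgroupComap Y
  have hq : q.comp f₀.toMonoidHom = f.toMonoidHom.comp q := by
    ext y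
    change g * y * g⁻¹ = f _
    rw [hf]
    rfl
  calc (ψ.res q).res f₀.toMonoidHom = ψ.res (q.comp f₀.toMonoidHom) := RepClass.res_res _ _ _
    _ = (ψ.res f.toMonoidHom).res q := by rw [hq, ← RepClass.res_res]
    _ = ψ.res q := by rw [hf']

/-- Let `X = X' Z` with `X' = [X, X]` and `Z` the center of `X`. The automorphism of `X'` induced
by `x ∈ X` is the inner automorphism induced by some `x' ∈ X'`, and the value at `x'` of a section
of `X' → X' / Z(X')` differs from `x` by an element of `Z`. -/
theorem exists_section_eq_mul {X Y Z : Subgroup G} [X.Normal]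
    (hZ : Z = (Subgroup.center X).map X.subtype) (hZY : Z ≤ Y)
    (hXZ : (X : Set G) = (⁅X, X⁆ : Subgroup G) * (Z : Set G)) (hZG : Z ≤ Subgroup.center G)
    (s : (⁅X, X⁆ : Subgroup G) ⧸ Subgroup.center (⁅X, X⁆ : Subgroup G) → (⁅X, X⁆ : Subgroup G))
    (hs : ∀ c, (QuotientGroup.mk (s c) : (⁅X, X⁆ : Subgroup G) ⧸ _) = c) {x : G} (hx : x ∈ X) :
    ∃ x' : (⁅X, X⁆ : Subgroup G), ∃ w ∈ Z, (s (QuotientGroup.mk x') : G) = x * w ∧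
      MulAut.conjNormal x = MulAut.conj x' ∧ (x ∈ Y → (x' : G) ∈ Y) := by
  have hx2 : x ∈ ((⁅X, X⁆ : Subgroup G) : Set G) * (Z : Set G) := hXZ ▸ hx
  obtain ⟨x', hx', z, hz, rfl⟩ := hx2
  -- the center of `X'` lies in the center of `X`, because `X = X' Z`
  have hcen : ∀ c ∈ Subgroup.center (⁅X, X⁆ : Subgroup G), (c : G) ∈ Z := by
    intro c hc
    have hcX : (c : G) ∈ X := Subgroup.commutator_le_self X c.2
    rw [hZ]
    refine ⟨⟨c, hcX⟩, Subgroup.mem_center_iff.2 fun y => Subtype.ext ?_, rfl⟩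
    have hy : (y : G) ∈ ((⁅X, X⁆ : Subgroup G) : Set G) * (Z : Set G) := hXZ ▸ y.2
    obtain ⟨y', hy', z', hz', hyz⟩ := hy
    have h1 : y' * c = c * y' :=
      congrArg Subtype.val (Subgroup.mem_center_iff.1 hc ⟨y', hy'⟩)
    have h2 := Subgroup.mem_center_iff.1 (hZG hz') c
    change (y : G) * c = c * y
    rw [← hyz]
    change y' * z' * c = c * (y' * z')
    rw [mul_assoc, ← h2, ← mul_assoc, h1, mul_assoc]
  let x'' : (⁅X, X⁆ : Subgroup G) := ⟨x', hx'⟩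
  have hdiff : x''⁻¹ * s (QuotientGroup.mk x'') ∈ Subgroup.center (⁅X, X⁆ : Subgroup G) :=
    QuotientGroup.eq.1 (hs _).symm
  refine ⟨x'', z⁻¹ * (x''⁻¹ * s (QuotientGroup.mk x'') : (⁅X, X⁆ : Subgroup G)),
    Z.mul_mem (Z.inv_mem hz) (hcen _ hdiff), ?_, ?_, fun hy => ?_⟩
  · simp [x'', mul_assoc]
  · ext y
    have h2 := Subgroup.mem_center_iff.1 (hZG hz) y
    change x' * z * y * (x' * z)⁻¹ = x' * y * x'⁻¹
    rw [mul_assoc x', ← h2]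
    group
  · exact (Subgroup.mul_mem_cancel_right Y (hZY hz)).1 hy

end GroupTheory

/-! ### The isomorphism of character triples -/

section Assembly

variable {F : Type u} [Field F]

/-- Central elements act on two irreducible representations lying over the same irreducible
representation by the same scalars. -/
theorem exists_common_central_scalar [IsAlgClosed F] {K G H V W : Type*} [Group K] [Group G]
    [Group H] [AddCommGroup V] [Module F V] [Module.Finite F V] [AddCommGroup W] [Module F W]
    [Module.Finite F W] {f : K →* G} (hf : ∀ k, f k ∈ Subgroup.center G) {f' : K →* H}
    (hf' : ∀ k, f' k ∈ Subgroup.center H) {ν : RepClass F K} (hν : ν ∈ IBr F K)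
    {ρ : Representation F G V} {σ : Representation F H W} (hρ : repClass ρ ∈ IBrOver f ν)
    (hσ : repClass σ ∈ IBrOver f' ν) :
    ∃ c : K → Fˣ, ∀ k, ρ (f k) = (c k : F) • (1 : Module.End F V) ∧
      σ (f' k) = (c k : F) • (1 : Module.End F W) := by
  obtain ⟨n, η, hη, rfl⟩ := hν
  obtain ⟨hρ, g, hg⟩ := (repClass_mem_IBrOver_iff f η ρ).1 hρ
  obtain ⟨hσ, g', hg'⟩ := (repClass_mem_IBrOver_iff f' η σ).1 hσ
  have := hη.nontrivial
  have key : ∀ k, ∃ c : Fˣ, ρ (f k) = (c : F) • (1 : Module.End F V) ∧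
      σ (f' k) = (c : F) • (1 : Module.End F W) := by
    intro k
    obtain ⟨c, h1, h2⟩ := exists_central_scalar hρ f hf g hg k
    obtain ⟨c', h1', h2'⟩ := exists_central_scalar hσ f' hf' g' hg' k
    have hcc : c = c' := smul_left_injective F
      (one_ne_zero : (1 : Module.End F (Fin n → F)) ≠ 0) (h2.symm.trans h2')
    have hc : c ≠ 0 := by
      rintro rfl
      rw [zero_smul] at h2
      have h3 : η k * η k⁻¹ = 1 := by rw [← map_mul, mul_inv_cancel, map_one]
      rw [h2, zero_mul] at h3
      exact zero_ne_one h3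
    exact ⟨Units.mk0 c hc, h1, hcc ▸ h1'⟩
  choose c hc using key
  exact ⟨c, hc⟩

/-- A homomorphism `h : H → A` with `A = h(H) N` induces an isomorphism from `A / N` to
`H / h⁻¹(N)`. -/
theorem exists_quotient_mulEquiv {A H : Type*} [Group A] [Group H] (h : H →* A)
    (N : Subgroup A) [N.Normal] (M : Subgroup H) [M.Normal] (hM : N.comap h = M)
    (hN : ∀ a, ∃ x, a⁻¹ * h x ∈ N) :
    ∃ τ : A ⧸ N ≃* H ⧸ M, ∀ x : H, τ.symm x = (h x : A ⧸ N) := by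
  refine ⟨(MulEquiv.ofBijective (QuotientGroup.map M N h hM.ge) ⟨?_, fun q => ?_⟩).symm,
    fun x => rfl⟩
  · rw [injective_iff_map_eq_one]
    intro q hq
    obtain ⟨x, rfl⟩ := QuotientGroup.mk_surjective q
    rw [QuotientGroup.map_mk, QuotientGroup.eq_one_iff] at hq
    rw [QuotientGroup.eq_one_iff, ← hM]
    exact hq
  · obtain ⟨a, rfl⟩ := QuotientGroup.mk_surjective q
    obtain ⟨x, hx⟩ := hN a
    exact ⟨x, (QuotientGroup.eq.2 hx).symm⟩

/-- Projective representations `P` of `G_χ` and `Q` of `N_G(Y)_ψ` with the same cocycle which on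
`X` and `Y` coincide with the linear representations `L` and `M`, up to multiplication of the
argument by elements of `Z`, yield an isomorphism of character triples. -/
theorem nonempty_iso_inertiaTriple [IsAlgClosed F] {G : Type v} [Group G]
    {X Y Z : Subgroup G} [X.Normal] (hZY : Z ≤ Y) (hYX : Y ≤ X)
    {ν : RepClass F Z} (hν : ν ∈ IBr F Z)
    {χ : RepClass F X} (hχ : χ ∈ IBrOver (Subgroup.inclusion (hZY.trans hYX)) ν)
    {ψ : RepClass F Y} (hψ : ψ ∈ IBrOver (Subgroup.inclusion hZY) ν)
    (hXZ : (X : Set G) = (⁅X, X⁆ : Subgroup G) * (Z : Set G)) (hZG : Z ≤ Subgroup.center G)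
    (hstabY : X ⊓ inertia Y ψ = Y) (hle : inertia Y ψ ≤ inertia X χ)
    (hprod : (inertia X χ : Set G) = (X : Set G) * (inertia Y ψ : Set G))
    {n m : ℕ} (L : Representation F X (Fin n → F)) (M : Representation F Y (Fin m → F))
    (hL : repClass L = χ) (hM : repClass M = ψ)
    (P : inertia X χ → Module.End F (Fin n → F)) (Q : inertia Y ψ → Module.End F (Fin m → F))
    (a : inertia X χ → inertia X χ → Fˣ) (hP1 : P 1 = 1)
    (hP : ∀ g k, P g * P k = (a g k : F) • P (g * k))
    (hQ : ∀ x y, Q x * Q y =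
      (a (Subgroup.inclusion hle x) (Subgroup.inclusion hle y) : F) • Q (x * y))
    (hPQ : ∀ x : X, ∃ w : Z,
      P ⟨x, le_inertia X χ x.2⟩ = L (x * Subgroup.inclusion (hZY.trans hYX) w) ∧
      ∀ hx : (x : G) ∈ Y,
        Q ⟨x, le_inertia Y ψ hx⟩ = M (⟨x, hx⟩ * Subgroup.inclusion hZY w)) :
    Nonempty (CharTriple.Iso (inertiaTriple X χ hχ.1) (inertiaTriple Y ψ hψ.1)) := by
  obtain ⟨c, hc⟩ := exists_common_central_scalar (f := Subgroup.inclusion (hZY.trans hYX))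
    (f' := Subgroup.inclusion hZY) (ρ := L) (σ := M)
    (fun k => Subgroup.mem_center_iff.2 fun g =>
      Subtype.ext (Subgroup.mem_center_iff.1 (hZG k.2) g))
    (fun k => Subgroup.mem_center_iff.2 fun g =>
      Subtype.ext (Subgroup.mem_center_iff.1 (hZG k.2) g))
    hν (by rw [hL]; exact hχ) (by rw [hM]; exact hψ)
  have hLirr : L.IsIrreducible := by
    rw [← repClass_mem_IBr_iff, hL]
    exact hχ.1
  have := hLirr.nontrivial
  choose w hPw hQw using hPQ
  have hPL : ∀ x : X, P ⟨x, le_inertia X χ x.2⟩ = (c (w x) : F) • L x := fun x => by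
    rw [hPw, map_mul, (hc _).1, mul_smul_comm, mul_one]
  have hQM : ∀ (x : X) (hx : (x : G) ∈ Y),
      Q ⟨x, le_inertia Y ψ hx⟩ = (c (w x) : F) • M ⟨x, hx⟩ := fun x hx => by
    rw [hQw, map_mul, (hc _).2, mul_smul_comm, mul_one]
  have hP0 : ∀ g, P g ≠ 0 := fun g hg => by
    have h1 := hP g g⁻¹
    rw [mul_inv_cancel, hP1, hg, zero_mul] at h1
    exact (smul_ne_zero (a g g⁻¹).ne_zero one_ne_zero) h1.symm
  have hconj : ∀ (g : inertia X χ) (x x' : X), (x' : G) = g * x * (g : G)⁻¹ →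
      P g * L x = L x' * P g := by
    intro g x x' hx'
    -- conjugation by `g`, as an automorphism of `X`
    let γ : X →* X := (MulAut.conjNormal (g : G) : MulAut X).toMonoidHom
    have hγ : ∀ y : X, ((γ y : X) : G) = g * y * (g : G)⁻¹ := fun y => MulAut.conjNormal_apply _ _
    -- `g x = γ(x) g` in `G_χ`, so `P g` intertwines `L` and `L ∘ γ` up to scalars
    have hscal : ∀ y : X, ∃ r : F, P g * L y = r • ((L.comp γ) y * P g) := by
      intro y
      have h1 : P g * P ⟨y, le_inertia X χ y.2⟩ = (a g ⟨y, le_inertia X χ y.2⟩ : F) •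
          P (g * ⟨y, le_inertia X χ y.2⟩) := hP _ _
      have h2 := hP ⟨γ y, le_inertia X χ (γ y).2⟩ g
      have h3 : (⟨γ y, le_inertia X χ (γ y).2⟩ * g : inertia X χ) =
          g * ⟨y, le_inertia X χ y.2⟩ := Subtype.ext (by
        change (γ y : G) * g = g * y
        rw [hγ, inv_mul_cancel_right])
      rw [h3] at h2
      rw [hPL, mul_smul_comm] at h1
      rw [hPL, smul_mul_assoc] at h2
      refine ⟨(c (w y) : F)⁻¹ * (a g ⟨y, le_inertia X χ y.2⟩ *
        ((a ⟨γ y, le_inertia X χ (γ y).2⟩ g : F)⁻¹ * c (w (γ y)))), ?_⟩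
      change _ = _ • (L (γ y) * P g)
      rw [mul_smul, mul_smul, mul_smul, h2, inv_smul_smul₀ (Units.ne_zero _), ← h1,
        inv_smul_smul₀ (Units.ne_zero _)]
    have hx : (x : G) ∈ ((⁅X, X⁆ : Subgroup G) : Set G) * (Z : Set G) := hXZ ▸ x.2
    obtain ⟨y, hy, z, hz, hyz⟩ := hx
    have hy' : y ∈ (commutator X).map X.subtype := by
      rw [Subgroup.map_subtype_commutator]
      exact hy
    obtain ⟨y, hy', rfl⟩ := hy'
    have h1 := mul_eq_mul_of_mem_commutator L (L.comp γ) (P g) (hP0 g) hscal hy'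
    have h2 : x = y * Subgroup.inclusion (hZY.trans hYX) ⟨z, hz⟩ := Subtype.ext hyz.symm
    have h3 : x' = γ y * Subgroup.inclusion (hZY.trans hYX) ⟨z, hz⟩ := Subtype.ext (by
      have h4 := Subgroup.mem_center_iff.1 (hZG hz) (g : G)⁻¹
      change (x' : G) = γ y * z
      rw [hx', hγ, ← hyz]
      change (g : G) * (y * z) * (g : G)⁻¹ = _
      rw [mul_assoc, mul_assoc (y : G), ← h4]
      group)
    rw [h2, h3, map_mul, map_mul, (hc _).1, ← mul_assoc, h1, mul_smul_comm, mul_one,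
      mul_smul_comm, smul_mul_assoc, mul_one]
    rfl
  let T := inertiaTriple X χ hχ.1
  let T' := inertiaTriple Y ψ hψ.1
  let h : inertia Y ψ →* inertia X χ := Subgroup.inclusion hle
  let θ : Representation F T.N (Fin n → F) := L.comp ((inertia X χ).subtype.subgroupComap X)
  let θ' : Representation F T'.N (Fin m → F) := M.comp ((inertia Y ψ).subtype.subgroupComap Y)
  have hθ : repClass θ = T.θ :=
    congrArg (fun ξ : RepClass F X => ξ.res ((inertia X χ).subtype.subgroupComap X)) hL
  have hθ' : repClass θ' = T'.θ :=
    congrArg (fun ξ : RepClass F Y => ξ.res ((inertia Y ψ).subtype.subgroupComap Y)) hM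
  -- both `P` and `Q` are rescaled by the scalars of the element `w x` of `Z` chosen for `x ∈ X`
  obtain ⟨P', Q', c', hP', hQ', hPθ, hQθ⟩ := exists_normalized_projective h T.N T'.N
    (fun x hx => hYX hx) P Q a hP1 hP hQ θ θ' (fun x => c (w ⟨x, x.2⟩)) (fun x => hPL ⟨x, x.2⟩)
    (fun x => hQM ⟨x, hYX x.2⟩ x.2)
    (fun g x x' hx => hconj g ⟨x, x.2⟩ ⟨x', x'.2⟩ (congrArg Subtype.val hx))
  obtain ⟨τ, hτ⟩ := exists_quotient_mulEquiv h T.N T'.N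
    (by
      ext x
      change (x : G) ∈ X ↔ (x : G) ∈ Y
      exact ⟨fun hx => hstabY.le ⟨hx, x.2⟩, fun hx => hYX hx⟩)
    (fun g => by
      have hg : (g : G) ∈ (X : Set G) * (inertia Y ψ : Set G) := hprod ▸ g.2
      obtain ⟨x, hx, k, hk, hxk⟩ := hg
      refine ⟨⟨k, hk⟩, ?_⟩
      change (g : G)⁻¹ * k ∈ X
      rw [← hxk]
      have h1 := ‹X.Normal›.conj_mem _ (X.inv_mem hx) k⁻¹
      simpa [mul_assoc] using h1)
  refine CharTriple.nonempty_iso_of_projective T T' τ c' θ θ' P' Q' hθ hθ' hP' (fun x y => ?_)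
    hPθ hQθ
  rw [hτ, hτ]
  exact hQ' x y

theorem CharTriple.Iso.encard_irrOver_top {G : Type v} {H : Type w} [Group G] [Group H]
    {T : CharTriple F G} {T' : CharTriple F H} (I : CharTriple.Iso T T') :
    (T.irrOver ⊤).encard = (T'.irrOver ⊤).encard := by
  have h : (⊤ : Subgroup (G ⧸ T.N)).map I.τ.toMonoidHom = ⊤ :=
    Subgroup.map_top_of_surjective _ I.τ.surjective
  have h1 := I.bijOn ⊤
  rw [← h, ← h1.image_eq, h1.injOn.encard_image]

end Assembly

theorem mainTheorem1 {F : Type*} [Field F] [IsAlgClosed F] {G : Type*} [Group G] [Finite G]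
    (X Y Z : Subgroup G) (hX : X.Normal)
    (hZ : Z = (Subgroup.center X).map X.subtype) (hZY : Z ≤ Y) (hYX : Y ≤ X)
    (ν : RepClass F Z) (hν : ν ∈ IBr F Z)
    (χ : RepClass F X) (hχ : χ ∈ IBrOver (Subgroup.inclusion (hZY.trans hYX)) ν)
    (ψ : RepClass F Y) (hψ : ψ ∈ IBrOver (Subgroup.inclusion hZY) ν)
    (hXZ : (X : Set G) = (⁅X, X⁆ : Subgroup G) * (Z : Set G)) (hZG : Z ≤ Subgroup.center G)
    (hstabY : X ⊓ inertia Y ψ = Y)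
    (hstab : Subgroup.normalizer (Y : Set G) ⊓ inertia X χ = inertia Y ψ)
    (hprod : (inertia X χ : Set G) = (X : Set G) * (inertia Y ψ : Set G))
    -- the condition for the restrictions to `⁅X, X⁆` and to `Y ⊓ ⁅X, X⁆`
    (hcoho : CohoCondition (Y.subgroupOf ⁅X, X⁆)
      (χ.res (Subgroup.inclusion (Subgroup.commutator_le_self X)))
      (ψ.res ((⁅X, X⁆ : Subgroup G).subtype.subgroupComap Y))) :
    Nonempty (CharTriple.Iso (inertiaTriple X χ hχ.1) (inertiaTriple Y ψ hψ.1)) ∧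
    (IBrOver X.subtype χ).encard =
      (IBrOver (Subgroup.inclusion (Subgroup.le_normalizer (H := Y))) ψ).encard := by
  have hle : inertia Y ψ ≤ inertia X χ := hstab.symm.trans_le inf_le_right
  have hiso : Nonempty (CharTriple.Iso (inertiaTriple X χ hχ.1) (inertiaTriple Y ψ hψ.1)) := by
    obtain ⟨n, m, P, α, Q, β, L, M, s, hPα, hQβ, hL, hM, -, hs, hPs, hQs, hαβ⟩ := hcoho
    obtain ⟨L₁, hL₁, hLL⟩ := exists_repClass_eq_restrict χ _ L hL
    obtain ⟨M₁, hM₁, hMM⟩ := exists_repClass_eq_restrict ψ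
      ((⁅X, X⁆ : Subgroup G).subtype.subgroupComap Y) M hM
    -- conjugation maps `G_χ` and `N_G(Y)_ψ` to the domains of `P` and `Q`
    let κ : inertia X χ → autStab (χ.res (Subgroup.inclusion (Subgroup.commutator_le_self X))) :=
      fun g => ⟨MulAut.conjNormal (g : G), conjNormal_mem_autStab _ g.2⟩
    let κ' : inertia Y ψ → autPairStab (Y.subgroupOf ⁅X, X⁆)
        (ψ.res ((⁅X, X⁆ : Subgroup G).subtype.subgroupComap Y)) :=
      fun g => ⟨MulAut.conjNormal (g : G), conjNormal_mem_autPairStab g.2⟩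
    have hκ : ∀ g k, κ (g * k) = κ g * κ k := fun g k => Subtype.ext (map_mul _ _ _)
    have hκ' : ∀ g k, κ' (g * k) = κ' g * κ' k := fun g k => Subtype.ext (map_mul _ _ _)
    refine nonempty_iso_inertiaTriple hZY hYX hν hχ hψ hXZ hZG hstabY hle hprod L₁ M₁ hL₁ hM₁
      (fun g => P (κ g)) (fun g => Q (κ' g)) (fun g k => α (κ g) (κ k)) ?_ (fun g k => ?_)
      (fun x y => ?_) (fun x => ?_)
    · have h1 : κ 1 = 1 := Subtype.ext (map_one _)
      rw [h1, hPα.map_one]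
      rfl
    · rw [hκ]
      exact hPα.map_mul _ _
    · have h1 : α (κ (Subgroup.inclusion hle x)) (κ (Subgroup.inclusion hle y)) =
          β (κ' x) (κ' y) := hαβ _ _ _ (κ' x).2 _ (κ' y).2
      rw [hκ', h1]
      exact hQβ.map_mul _ _
    · obtain ⟨x', w, hw, hxw, hconj, hY⟩ := exists_section_eq_mul hZ hZY hXZ hZG s hs x.2
      refine ⟨⟨w, hw⟩, ?_, fun hx => ?_⟩
      · rw [hPs x' (κ ⟨x, _⟩) hconj, ← hLL]
        exact congrArg L₁ (Subtype.ext hxw)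
      · have ht : s (QuotientGroup.mk x') ∈ Y.subgroupOf ⁅X, X⁆ := by
          rw [Subgroup.mem_subgroupOf, hxw]
          exact Y.mul_mem hx (hZY hw)
        rw [hQs ⟨x', hY hx⟩ (κ' ⟨x, _⟩) ⟨_, ht⟩ hconj rfl]
        exact (hMM ⟨_, ht⟩).symm.trans (congrArg M₁ (Subtype.ext hxw))
  refine ⟨hiso, ?_⟩
  obtain ⟨I⟩ := hiso
  rw [encard_IBrOver_eq_irrOver_top X χ hχ.1 (MonoidHom.id G) Function.injective_id
      (fun g _ => ⟨g, rfl⟩) (fun g _ => by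
        rw [Subgroup.normalizer_eq_top]
        exact Subgroup.mem_top g) X.subtype (fun k => rfl),
    encard_IBrOver_eq_irrOver_top Y ψ hψ.1 (Subgroup.normalizer (Y : Set G)).subtype
      (Subgroup.subtype_injective _)
      (by rw [Subgroup.range_subtype]; exact inertia_le_normalizer Y ψ)
      (by rw [Subgroup.range_subtype])
      (Subgroup.inclusion (Subgroup.le_normalizer (H := Y))) (fun k => rfl)]
  exact I.encard_irrOver_top
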